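/- There are a deterministic algorithm, a polynomial $p$ and an absolute constant $c>0$ such that the following holds. Let $f_1,\dots,f_n$ be closed axis-aligned boxes in the plane, $f_i=[l_i,r_i]\times[b_i,t_i]$ with real coordinates $l_i\le r_i$ and $b_i\le t_i$, and let $w_1,\dots,w_n>0$ be real weights. Call $J\subseteq\{1,\dots,n\}$ independent if $f_i\cap f_j=\emptyset$ for all distinct $i,j\in J$, and let $\mathrm{opt}$ be the maximum of $\sum_{i\in J}w_i$ over all independent sets $J$. Given the numbers $n,l_i,r_i,b_i,t_i,w_i$, the algorithm halts after at most $p(n)$ steps and outputs an independent set $J$; moreover, if $n\ge 3$, then $$\sum_{i\in J}w_i\ \ge\ c\cdot\frac{\log\log n}{\log n}\cdot\mathrm{opt}.$$ Here an algorithm is a program, independent of $n$, for a real random access machine that has arrays of natural numbers and arrays of real numbers with indirect addressing by natural numbers, whose operations on reals are addition, subtraction and comparison, whose operations on natural numbers are addition, truncated subtraction, halving and comparison, and whose only constants are natural numbers; each executed assignment and each evaluated test counts as one step. -/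

import Mathlib

/-! ## Weighted axis-aligned boxes -/

/-- A closed axis-aligned box `[left, right] × [bottom, top]` in the plane, with a positive
weight. -/
structure WeightedBox where
  left : ℝ
  right : ℝ
  bottom : ℝ
  top : ℝ
  weight : ℝ
  left_le_right : left ≤ right
  bottom_le_top : bottom ≤ top
  weight_pos : 0 < weight

namespace WeightedBox

/-- The set of points of the plane that the box occupies. -/
def region (b : WeightedBox) : Set (ℝ × ℝ) :=
  Set.Icc b.left b.right ×ˢ Set.Icc b.bottom b.top

/-- A set of (indices of) boxes is independent if no two of the boxes intersect. -/
def IsIndependent {n : ℕ} (B : Fin n → WeightedBox) (J : Finset (Fin n)) : Prop :=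
  ∀ i ∈ J, ∀ j ∈ J, i ≠ j → (B i).region ∩ (B j).region = ∅

/-- The total weight of a set of boxes. -/
noncomputable def totalWeight {n : ℕ} (B : Fin n → WeightedBox) (J : Finset (Fin n)) : ℝ :=
  ∑ i ∈ J, (B i).weight

/-- The maximum total weight of an independent set (see `isGreatest_opt`). -/
noncomputable def opt {n : ℕ} (B : Fin n → WeightedBox) : ℝ :=
  sSup (totalWeight B '' {J | IsIndependent B J})

theorem isGreatest_opt {n : ℕ} (B : Fin n → WeightedBox) :
    IsGreatest (totalWeight B '' {J | IsIndependent B J}) (opt B) := by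
  have hfin : (totalWeight B '' {J | IsIndependent B J}).Finite := Set.toFinite _
  have hne : (totalWeight B '' {J | IsIndependent B J}).Nonempty :=
    ⟨_, ∅, by simp [IsIndependent], rfl⟩
  exact ⟨hne.csSup_mem hfin, fun _ h => le_csSup hfin.bddAbove h⟩

end WeightedBox

/-! ## A real random access machine

The memory consists of arrays of natural numbers and arrays of real numbers, each with cells
indexed by `ℕ`; a program names finitely many arrays, and addresses cells by computed indices.
The arithmetic on real numbers is addition and subtraction only, the arithmetic on natural
numbers is addition, truncated subtraction and halving, the only constants are natural numbers,
and real numbers can otherwise only be compared. There is no multiplication, no rounding and no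
conversion from reals to naturals, so in `t` steps a fixed program lengthens the numbers in
memory by only `O(t)` bits, and charging one unit per step is fair also in the bit model. -/

namespace RealRAM

/-- The memory: `nat a i` and `real a i` are cell `i` of the natural, respectively real,
array `a`. -/
structure State where
  nat : ℕ → ℕ → ℕ
  real : ℕ → ℕ → ℝ

/-- Expressions with natural number values. -/
inductive NatExpr where
  | lit (k : ℕ)
  | get (a : ℕ) (i : NatExpr)
  | add (e f : NatExpr)
  | sub (e f : NatExpr)
  | half (e : NatExpr)

/-- Expressions with real values. -/
inductive RealExpr where
  | lit (k : ℕ)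
  | get (a : ℕ) (i : NatExpr)
  | add (e f : RealExpr)
  | sub (e f : RealExpr)

/-- Tests that govern branching. -/
inductive Test where
  | natLt (e f : NatExpr)
  | realLt (e f : RealExpr)
  | neg (b : Test)
  | conj (b c : Test)

/-- Programs. -/
inductive Program where
  | skip
  | setNat (a : ℕ) (i : NatExpr) (e : NatExpr)
  | setReal (a : ℕ) (i : NatExpr) (e : RealExpr)
  | seq (P Q : Program)
  | branch (b : Test) (P Q : Program)
  | loop (b : Test) (P : Program)

def NatExpr.eval (s : State) : NatExpr → ℕ
  | .lit k => k
  | .get a i => s.nat a (i.eval s)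
  | .add e f => e.eval s + f.eval s
  | .sub e f => e.eval s - f.eval s
  | .half e => e.eval s / 2

noncomputable def RealExpr.eval (s : State) : RealExpr → ℝ
  | .lit k => (k : ℝ)
  | .get a i => s.real a (i.eval s)
  | .add e f => e.eval s + f.eval s
  | .sub e f => e.eval s - f.eval s

def Test.Holds (s : State) : Test → Prop
  | .natLt e f => e.eval s < f.eval s
  | .realLt e f => e.eval s < f.eval s
  | .neg b => ¬ b.Holds s
  | .conj b c => b.Holds s ∧ c.Holds s

/-- Write `v` into cell `i` of the natural array `a`. -/
def State.writeNat (s : State) (a i v : ℕ) : State :=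
  { s with nat := Function.update s.nat a (Function.update (s.nat a) i v) }

/-- Write `v` into cell `i` of the real array `a`. -/
def State.writeReal (s : State) (a i : ℕ) (v : ℝ) : State :=
  { s with real := Function.update s.real a (Function.update (s.real a) i v) }

/-- `Exec P s t s'`: started in memory state `s`, the program `P` halts after `t` steps in state
`s'`. Every executed assignment (or `skip`) and every evaluated test is one step; expressions and
tests have a fixed size given by the program, so this is the number of elementary operations up
to a factor that depends on the program only. -/
inductive Exec : Program → State → ℕ → State → Prop
  | skip (s : State) : Exec .skip s 1 s
  | setNat (a : ℕ) (i e : NatExpr) (s : State) :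
      Exec (.setNat a i e) s 1 (s.writeNat a (i.eval s) (e.eval s))
  | setReal (a : ℕ) (i : NatExpr) (e : RealExpr) (s : State) :
      Exec (.setReal a i e) s 1 (s.writeReal a (i.eval s) (e.eval s))
  | seq {P Q : Program} {s s' s'' : State} {t t' : ℕ} :
      Exec P s t s' → Exec Q s' t' s'' → Exec (.seq P Q) s (t + t') s''
  | branchTrue {b : Test} {P Q : Program} {s s' : State} {t : ℕ} :
      b.Holds s → Exec P s t s' → Exec (.branch b P Q) s (t + 1) s'
  | branchFalse {b : Test} {P Q : Program} {s s' : State} {t : ℕ} :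
      ¬ b.Holds s → Exec Q s t s' → Exec (.branch b P Q) s (t + 1) s'
  | loopStop {b : Test} {P : Program} {s : State} :
      ¬ b.Holds s → Exec (.loop b P) s 1 s
  | loopStep {b : Test} {P : Program} {s s' s'' : State} {t t' : ℕ} :
      b.Holds s → Exec P s t s' → Exec (.loop b P) s' t' s'' →
        Exec (.loop b P) s (t + t' + 1) s''

/-- The machine is deterministic: final state and number of steps are unique. -/
theorem Exec.unique {P : Program} {s s₁ : State} {t₁ : ℕ} (h₁ : Exec P s t₁ s₁) :
    ∀ {t₂ : ℕ} {s₂ : State}, Exec P s t₂ s₂ → t₁ = t₂ ∧ s₁ = s₂ := by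
  induction h₁ with
  | skip s => intro _ _ h; cases h; exact ⟨rfl, rfl⟩
  | setNat a i e s => intro _ _ h; cases h; exact ⟨rfl, rfl⟩
  | setReal a i e s => intro _ _ h; cases h; exact ⟨rfl, rfl⟩
  | seq _ _ ih ih' =>
    intro _ _ h
    cases h with
    | seq g g' =>
      obtain ⟨rfl, rfl⟩ := ih g
      obtain ⟨rfl, rfl⟩ := ih' g'
      exact ⟨rfl, rfl⟩
  | branchTrue hb _ ih =>
    intro _ _ h
    cases h with
    | branchTrue _ g => obtain ⟨rfl, rfl⟩ := ih g; exact ⟨rfl, rfl⟩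
    | branchFalse hb' _ => exact absurd hb hb'
  | branchFalse hb _ ih =>
    intro _ _ h
    cases h with
    | branchTrue hb' _ => exact absurd hb' hb
    | branchFalse _ g => obtain ⟨rfl, rfl⟩ := ih g; exact ⟨rfl, rfl⟩
  | loopStop hb =>
    intro _ _ h
    cases h with
    | loopStop _ => exact ⟨rfl, rfl⟩
    | loopStep hb' _ _ => exact absurd hb' hb
  | loopStep hb _ _ ih ih' =>
    intro _ _ h
    cases h with
    | loopStop hb' => exact absurd hb hb'
    | loopStep _ g g' =>
      obtain ⟨rfl, rfl⟩ := ih g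
      obtain ⟨rfl, rfl⟩ := ih' g'
      exact ⟨rfl, rfl⟩

/-- The initial memory for the input `B`: cell `0` of the natural array `0` holds the number of
boxes, and cell `i` of the real arrays `0, …, 4` holds the left, right, bottom and top coordinate
and the weight of the `i`-th box. All other cells hold `0`. -/
noncomputable def input {n : ℕ} (B : Fin n → WeightedBox) : State where
  nat a i := if a = 0 ∧ i = 0 then n else 0
  real a i :=
    if h : i < n then
      match a with
      | 0 => (B ⟨i, h⟩).left
      | 1 => (B ⟨i, h⟩).right
      | 2 => (B ⟨i, h⟩).bottom
      | 3 => (B ⟨i, h⟩).top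
      | 4 => (B ⟨i, h⟩).weight
      | _ => 0
    else 0

/-- The output that is read off the final memory: the set of all `i < n` such that cell `i` of
the natural array `1` is nonzero. -/
def output (n : ℕ) (s : State) : Finset (Fin n) :=
  {i | s.nat 1 i ≠ 0}

end RealRAM

/-! The boxes are first reduced to a list of bounded depth. Each point of the grid spanned by the
left and bottom coordinates costs `2 ^ m` once `m` listed boxes contain it, and one keeps listing
the box with the least price per weight until the total price reaches `2 ^ T`, where `T = 4 * ℓ`
and `ℓ = ⌈log₂ n⌉`. An independent set of weight `opt` shares the total price among its boxes, so
listing a box of weight `w` raises the total price at most by the factor `1 + w / opt`. As the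
total price starts at `n ^ 2`, the list has weight at least `ℓ * opt`, while no grid point lies in
more than `T` of its boxes.

Two boxes that intersect without crossing are in conflict; the conflict graph of the list is
`8 * T`-degenerate. With `Q = 8 * T`, the boxes are coloured along the reversed degeneracy order
with `2 * Q + 1` colours. At least half of the colours cause no conflict, and the best of these, by
the method of conditional expectations, does not increase a potential that bounds
`(Q + 1) ^ D`, where `D` is the maximal number of boxes of one colour at a grid point. Hence
`(Q + 1) ^ D` is polynomial in `n`, that is, `D = O(log n / log log n)`.

Boxes of one colour either cross or are disjoint. The level of a box is the maximal number of boxes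
of its colour that cross it vertically over a common abscissa; it is less than `D`, and crossing
boxes have different levels. So the pairs of a colour and a level split the list into
`(2 * Q + 1) * D ≤ 65 * ℓ * D` independent sets, the heaviest of which has weight at least
`opt / (65 * D)`.

All phases fill arrays by rules composed of sums, counts and searches of polynomial length and of
products with powers whose base and exponent are small. -/

/-! ## Verified programs in polynomial time -/

namespace RealRAM

section Memory

/-- The natural array that serves, together with `realStack`, as an evaluation stack. -/
abbrev natStack : ℕ := 2

/-- The real array that serves, together with `natStack`, as an evaluation stack. -/
abbrev realStack : ℕ := 5

@[simp] theorem State.writeNat_nat (s : State) (a i v a' i' : ℕ) :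
    (s.writeNat a i v).nat a' i' = if a' = a ∧ i' = i then v else s.nat a' i' := by
  simp only [State.writeNat, Function.update_apply]
  split_ifs <;> simp_all

@[simp] theorem State.writeNat_real (s : State) (a i v : ℕ) :
    (s.writeNat a i v).real = s.real := rfl

@[simp] theorem State.writeReal_nat (s : State) (a i : ℕ) (v : ℝ) :
    (s.writeReal a i v).nat = s.nat := rfl

@[simp] theorem State.writeReal_real (s : State) (a i : ℕ) (v : ℝ) (a' i' : ℕ) :
    (s.writeReal a i v).real a' i' = if a' = a ∧ i' = i then v else s.real a' i' := by
  simp only [State.writeReal, Function.update_apply]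
  split_ifs <;> simp_all

theorem State.ext_cells {s s' : State} (h : ∀ a i, s.nat a i = s'.nat a i)
    (hr : ∀ a i, s.real a i = s'.real a i) : s = s' := by
  cases s; cases s'
  simp only [State.mk.injEq]
  exact ⟨funext₂ h, funext₂ hr⟩

/-- The memory with the evaluation stacks erased. -/
def State.clean (s : State) : State where
  nat a i := if a = natStack then 0 else s.nat a i
  real a i := if a = realStack then 0 else s.real a i

/-- The number of boxes of the input, in terms of which running times are measured. -/
def State.size (s : State) : ℕ := s.nat 0 0

@[simp] theorem State.size_clean (s : State) : s.clean.size = s.size := rfl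

theorem State.clean_nat (s : State) {a : ℕ} (h : a ≠ natStack) (i : ℕ) :
    s.clean.nat a i = s.nat a i := if_neg h

theorem State.clean_real (s : State) {a : ℕ} (h : a ≠ realStack) (i : ℕ) :
    s.clean.real a i = s.real a i := if_neg h

@[simp] theorem State.clean_writeNat_stack (s : State) (i v : ℕ) :
    (s.writeNat natStack i v).clean = s.clean := by
  refine State.ext_cells (fun a j => ?_) fun a j => rfl
  by_cases h : a = natStack <;> simp [State.clean, h]

@[simp] theorem State.clean_writeReal_stack (s : State) (i : ℕ) (v : ℝ) :
    (s.writeReal realStack i v).clean = s.clean := by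
  refine State.ext_cells (fun a j => rfl) fun a j => ?_
  by_cases h : a = realStack <;> simp [State.clean, h]

theorem State.clean_writeNat (s : State) {a : ℕ} (h : a ≠ natStack) (i v : ℕ) :
    (s.writeNat a i v).clean = s.clean.writeNat a i v := by
  refine State.ext_cells (fun a' j => ?_) fun a' j => rfl
  by_cases h' : a' = natStack
  · simp [State.clean, h', h.symm]
  · simp [State.clean, h']

theorem State.clean_input {n : ℕ} (B : Fin n → WeightedBox) : (input B).clean = input B := by
  refine State.ext_cells (fun a i => ?_) fun a i => ?_
  · by_cases h : a = natStack <;> simp [State.clean, input, h]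
  · by_cases h : a = realStack
    · by_cases hi : i < n <;> simp [State.clean, input, h, hi]
    · simp [State.clean, h]

/-- `Agree e s s'`: the states differ at most in the stack cells with index `e` or more. -/
structure Agree (e : ℕ) (s s' : State) : Prop where
  clean : s'.clean = s.clean
  nat : ∀ i < e, s'.nat natStack i = s.nat natStack i
  real : ∀ i < e, s'.real realStack i = s.real realStack i

/-- The values of variables that are kept in the stack cells `loc i`. -/
def State.vars {d : ℕ} (s : State) (loc : Fin d → ℕ) : Fin d → ℕ := fun i => s.nat natStack (loc i)

namespace Agree

variable {d e e' i : ℕ} {s s' s'' : State}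

theorem trans (h : Agree e s s') (h' : Agree e s' s'') : Agree e s s'' :=
  ⟨h'.clean.trans h.clean, fun i hi => (h'.nat i hi).trans (h.nat i hi),
    fun i hi => (h'.real i hi).trans (h.real i hi)⟩

theorem mono (h : Agree e' s s') (he : e ≤ e') : Agree e s s' :=
  ⟨h.clean, fun i hi => h.nat i (hi.trans_le he), fun i hi => h.real i (hi.trans_le he)⟩

theorem writeNat (s : State) (v : ℕ) (h : e ≤ i) : Agree e s (s.writeNat natStack i v) :=
  ⟨by simp, fun j hj => by simp [(hj.trans_le h).ne], fun _ _ => rfl⟩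

theorem writeReal (s : State) (v : ℝ) (h : e ≤ i) : Agree e s (s.writeReal realStack i v) :=
  ⟨by simp, fun _ _ => rfl, fun j hj => by simp [(hj.trans_le h).ne]⟩

theorem size (h : Agree e s s') : s'.size = s.size := by
  rw [← s'.size_clean, h.clean, s.size_clean]

theorem vars (h : Agree e s s') {loc : Fin d → ℕ} (hl : ∀ i, loc i < e) :
    s'.vars loc = s.vars loc :=
  funext fun i => h.nat _ (hl i)

end Agree

end Memory

section Halting

/-- Total correctness with a time bound: started in the state `s`, the program `P` halts after at
most `τ` steps, in a state with property `post`. -/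
def HaltsWithin (P : Program) (s : State) (τ : ℕ) (post : State → Prop) : Prop :=
  ∃ t s', Exec P s t s' ∧ t ≤ τ ∧ post s'

namespace HaltsWithin

variable {P Q : Program} {b : Test} {s : State} {τ τ' : ℕ} {post post' mid : State → Prop}

theorem mono (h : HaltsWithin P s τ post) (hτ : τ ≤ τ') (hpost : ∀ s', post s' → post' s') :
    HaltsWithin P s τ' post' := by
  obtain ⟨t, s', hx, ht, hs'⟩ := h
  exact ⟨t, s', hx, ht.trans hτ, hpost s' hs'⟩

theorem of_exec {s' : State} (hx : Exec P s 1 s') (h : post s') : HaltsWithin P s 1 post :=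
  ⟨1, s', hx, le_rfl, h⟩

theorem setNat {a : ℕ} {i e : NatExpr} (h : post (s.writeNat a (i.eval s) (e.eval s))) :
    HaltsWithin (.setNat a i e) s 1 post :=
  of_exec (.setNat a i e s) h

theorem setReal {a : ℕ} {i : NatExpr} {e : RealExpr}
    (h : post (s.writeReal a (i.eval s) (e.eval s))) : HaltsWithin (.setReal a i e) s 1 post :=
  of_exec (.setReal a i e s) h

theorem seq (h : HaltsWithin P s τ mid) (h' : ∀ s', mid s' → HaltsWithin Q s' τ' post) :
    HaltsWithin (.seq P Q) s (τ + τ') post := by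
  obtain ⟨t, s', hx, ht, hs'⟩ := h
  obtain ⟨t', s'', hx', ht', hs''⟩ := h' s' hs'
  exact ⟨_, s'', .seq hx hx', Nat.add_le_add ht ht', hs''⟩

theorem branch (h : b.Holds s → HaltsWithin P s τ post)
    (h' : ¬ b.Holds s → HaltsWithin Q s τ post) : HaltsWithin (.branch b P Q) s (τ + 1) post := by
  by_cases hb : b.Holds s
  · obtain ⟨t, s', hx, ht, hs'⟩ := h hb
    exact ⟨_, s', .branchTrue hb hx, Nat.succ_le_succ ht, hs'⟩
  · obtain ⟨t, s', hx, ht, hs'⟩ := h' hb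
    exact ⟨_, s', .branchFalse hb hx, Nat.succ_le_succ ht, hs'⟩

theorem loop {N : ℕ} {I : ℕ → State → Prop}
    (step : ∀ k < N, ∀ s, I k s → b.Holds s ∧ HaltsWithin Q s τ (I (k + 1)))
    (final : ∀ s, I N s → ¬ b.Holds s) (h : I 0 s) :
    HaltsWithin (.loop b Q) s (N * (τ + 1) + 1) (I N) := by
  suffices key : ∀ m k, k + m = N → ∀ s, I k s →
      HaltsWithin (.loop b Q) s (m * (τ + 1) + 1) (I N) from key N 0 (zero_add N) s h
  intro m
  induction m with
  | zero =>
    rintro k rfl s hs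
    exact ⟨1, s, .loopStop (final s hs), by omega, hs⟩
  | succ m ih =>
    intro k hk s hs
    obtain ⟨hb, t, s', hx, ht, hs'⟩ := step k (by omega) s hs
    obtain ⟨t', s'', hx', ht', hs''⟩ := ih (k + 1) (by omega) s' hs'
    refine ⟨_, s'', .loopStep hb hx hx', ?_, hs''⟩
    rw [Nat.succ_mul]
    omega

end HaltsWithin

/-- Run `Q` while the stack cell `c` counts from `0` to the value of the stack cell `m`. -/
def forLoop (c m : ℕ) (Q : Program) : Program :=
  .seq (.setNat natStack (.lit c) (.lit 0))
    (.loop (.natLt (.get natStack (.lit c)) (.get natStack (.lit m)))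
      (.seq Q (.setNat natStack (.lit c) (.add (.get natStack (.lit c)) (.lit 1)))))

theorem HaltsWithin.forLoop {Q : Program} {s : State} {c m N τ : ℕ} {I : ℕ → State → Prop}
    (hcount : ∀ k s, I k s → s.nat natStack c = k ∧ s.nat natStack m = N)
    (h : I 0 (s.writeNat natStack c 0))
    (step : ∀ k < N, ∀ s, I k s →
      HaltsWithin Q s τ fun s' =>
        s'.nat natStack c = k ∧ I (k + 1) (s'.writeNat natStack c (k + 1))) :
    HaltsWithin (forLoop c m Q) s (N * (τ + 2) + 2) (I N) := by
  have hloop := HaltsWithin.loop (b := .natLt (.get natStack (.lit c)) (.get natStack (.lit m)))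
    (Q := .seq Q (.setNat natStack (.lit c) (.add (.get natStack (.lit c)) (.lit 1))))
    (τ := τ + 1) (I := I) (N := N) ?_ ?_ h
  · have hinit : HaltsWithin (.setNat natStack (.lit c) (.lit 0)) s 1
        (· = s.writeNat natStack c 0) := .setNat rfl
    exact (hinit.seq fun s' hs' => hs' ▸ hloop).mono (le_of_eq (by ring)) fun _ => id
  · intro k hk s hs
    obtain ⟨hc, hm⟩ := hcount k s hs
    refine ⟨by simpa [Test.Holds, NatExpr.eval, hc, hm] using hk, (step k hk s hs).seq fun s' h' =>
      .setNat ?_⟩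
    simpa [NatExpr.eval, h'.1] using h'.2
  · intro s hs
    obtain ⟨hc, hm⟩ := hcount N s hs
    simp [Test.Holds, NatExpr.eval, hc, hm]

end Halting

section StackValues

/-- The two kinds of values, `ℕ` and `ℝ`, that the machine keeps on its stack, with the one-step
programs and tests that handle them. -/
class StackValue (α : Type) [AddCommMonoid α] [LinearOrder α] where
  /-- The value in a stack cell. -/
  peek : State → ℕ → α
  /-- Replace the value in a stack cell. -/
  poke : State → ℕ → α → State
  /-- The program that resets a stack cell. -/
  clear : ℕ → Program
  /-- The program that adds to a stack cell the value of another one. -/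
  accumulate : ℕ → ℕ → Program
  /-- The test whether one stack cell has a smaller value than another one. -/
  less : ℕ → ℕ → Test
  agree_poke (s : State) (e : ℕ) (x : α) : Agree e s (poke s e x)
  poke_nat (s : State) {e i : ℕ} (x : α) :
    i ≠ e → (poke s e x).nat natStack i = s.nat natStack i
  poke_real (s : State) {e i : ℕ} (x : α) :
    i ≠ e → (poke s e x).real realStack i = s.real realStack i
  peek_poke (s : State) (e : ℕ) (x : α) : peek (poke s e x) e = x
  peek_congr {s s' : State} {e : ℕ} : s'.nat natStack e = s.nat natStack e →
    s'.real realStack e = s.real realStack e → peek s' e = peek s e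
  exec_clear (s : State) (e : ℕ) : Exec (clear e) s 1 (poke s e 0)
  exec_accumulate (s : State) (e i : ℕ) :
    Exec (accumulate e i) s 1 (poke s e (peek s e + peek s i))
  holds_less (s : State) (e i : ℕ) : (less e i).Holds s ↔ peek s e < peek s i

open StackValue

noncomputable instance : StackValue ℕ where
  peek s e := s.nat natStack e
  poke s e x := s.writeNat natStack e x
  clear e := .setNat natStack (.lit e) (.lit 0)
  accumulate e i :=
    .setNat natStack (.lit e) (.add (.get natStack (.lit e)) (.get natStack (.lit i)))
  less e i := .natLt (.get natStack (.lit e)) (.get natStack (.lit i))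
  agree_poke s e x := .writeNat s x le_rfl
  poke_nat s e i x h := by simp [h]
  poke_real s e i x _ := rfl
  peek_poke s e x := by simp
  peek_congr h _ := h
  exec_clear s e := .setNat _ _ _ s
  exec_accumulate s e i := .setNat _ _ _ s
  holds_less s e i := Iff.rfl

noncomputable instance : StackValue ℝ where
  peek s e := s.real realStack e
  poke s e x := s.writeReal realStack e x
  clear e := .setReal realStack (.lit e) (.lit 0)
  accumulate e i :=
    .setReal realStack (.lit e) (.add (.get realStack (.lit e)) (.get realStack (.lit i)))
  less e i := .realLt (.get realStack (.lit e)) (.get realStack (.lit i))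
  agree_poke s e x := .writeReal s x le_rfl
  poke_nat s e i x _ := rfl
  poke_real s e i x h := by simp [h]
  peek_poke s e x := by simp
  peek_congr _ h := h
  exec_clear s e := by
    simpa [RealExpr.eval, NatExpr.eval] using Exec.setReal realStack (.lit e) (.lit 0) s
  exec_accumulate s e i := .setReal _ _ _ s
  holds_less s e i := Iff.rfl

variable {α : Type} [AddCommMonoid α] [LinearOrder α] [StackValue α]

theorem HaltsWithin.clear {s : State} {e : ℕ} {post : State → Prop} (h : post (poke s e (0 : α))) :
    HaltsWithin (clear α e) s 1 post :=
  .of_exec (exec_clear s e) h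

theorem HaltsWithin.accumulate {s : State} {e i : ℕ} {post : State → Prop}
    (h : post (poke s e (peek s e + peek s i : α))) : HaltsWithin (accumulate α e i) s 1 post :=
  .of_exec (exec_accumulate s e i) h

theorem Agree.peek {e i : ℕ} {s s' : State} (h : Agree e s s') (hi : i < e) :
    (peek s' i : α) = peek s i :=
  peek_congr (h.nat i hi) (h.real i hi)

/-- Add up in the cell `e` the values that `Q` produces in the cell `e + 3` while the cell `e + 2`
counts up to the value of the cell `e + 1`. -/
def sumLoop (α : Type) [AddCommMonoid α] [LinearOrder α] [StackValue α] (e : ℕ) (Q : Program) :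
    Program :=
  .seq (clear α e) (forLoop (e + 2) (e + 1) (.seq Q (accumulate α e (e + 3))))

theorem HaltsWithin.sumLoop {s : State} {e N τ : ℕ} {Q : Program} {x : ℕ → α}
    (hN : s.nat natStack (e + 1) = N)
    (hQ : ∀ k < N, ∀ s', Agree e s s' → s'.nat natStack (e + 2) = k →
      HaltsWithin Q s' τ fun s'' => Agree (e + 3) s' s'' ∧ peek s'' (e + 3) = x k) :
    HaltsWithin (sumLoop α e Q) s (N * (τ + 3) + 3) fun s' =>
      Agree e s s' ∧ peek s' e = ∑ k ∈ Finset.range N, x k := by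
  set I : ℕ → State → Prop := fun k s' => Agree e s s' ∧
    peek s' e = ∑ k ∈ Finset.range k, x k ∧ s'.nat natStack (e + 2) = k ∧
    s'.nat natStack (e + 1) = N
  have hinit : I 0 ((poke s e (0 : α)).writeNat natStack (e + 2) 0) := by
    have hA := Agree.writeNat (poke s e (0 : α)) 0 (show e + 1 ≤ e + 2 by omega)
    refine ⟨(agree_poke s e (0 : α)).trans (hA.mono e.le_succ), ?_, by simp, ?_⟩
    · rw [hA.peek e.lt_succ_self, peek_poke, Finset.sum_range_zero]
    · simp [poke_nat, hN]
  have hloop := HaltsWithin.forLoop (fun k s' hI => hI.2.2) hinit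
    (Q := .seq Q (StackValue.accumulate α e (e + 3))) (N := N) (τ := τ + 1)
    fun k hk s₁ ⟨hA, hv, hc, hm⟩ =>
      (hQ k hk s₁ hA hc).seq fun s₂ ⟨hA', hv'⟩ => .accumulate ?_
  · exact (HaltsWithin.clear (post := (· = poke s e (0 : α))) rfl).seq
      (fun s' hs' => hs' ▸ hloop) |>.mono (le_of_eq (by ring)) fun s' hI => ⟨hI.1, hI.2.1⟩
  · set s₃ := poke s₂ e (peek s₂ e + peek s₂ (e + 3) : α)
    have hA₃ := Agree.writeNat s₃ (k + 1) (le_refl (e + 2))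
    refine ⟨?_, ((hA.trans (hA'.mono (by omega))).trans (agree_poke s₂ e _)).trans
      (hA₃.mono (by omega)), ?_, by simp, ?_⟩
    · rw [poke_nat _ _ (by omega), hA'.nat _ (by omega), hc]
    · rw [hA₃.peek (by omega), peek_poke, hA'.peek (by omega), hv, hv', Finset.sum_range_succ]
    · rw [hA₃.nat _ (by omega), poke_nat _ _ (by omega), hA'.nat _ (by omega), hm]

/-- Multiply the value in the cell `e` by the number in the cell `e + 1`. -/
def scale (α : Type) [AddCommMonoid α] [LinearOrder α] [StackValue α] (e : ℕ) : Program :=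
  .seq (.setNat natStack (.lit (e + 5)) (.get natStack (.lit (e + 1))))
    (.seq (sumLoop α (e + 4) (.seq (clear α (e + 7)) (accumulate α (e + 7) e)))
      (.seq (clear α e) (accumulate α e (e + 4))))

theorem HaltsWithin.scale (s : State) (e : ℕ) :
    HaltsWithin (scale α e) s (s.nat natStack (e + 1) * 5 + 6) fun s' => Agree e s s' ∧
      (∀ i, e < i → i < e + 4 → s'.nat natStack i = s.nat natStack i) ∧
      peek s' e = s.nat natStack (e + 1) • (peek s e : α) := by
  set b := s.nat natStack (e + 1)
  set s₁ := s.writeNat natStack (e + 5) b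
  have hA₁ : Agree (e + 4) s s₁ := .writeNat s b (by omega)
  have hcopy : ∀ s', Agree (e + 4) s₁ s' →
      HaltsWithin (.seq (StackValue.clear α (e + 7)) (StackValue.accumulate α (e + 7) e)) s' 2
        fun s'' => Agree (e + 4 + 3) s' s'' ∧ peek s'' (e + 4 + 3) = (peek s e : α) := by
    intro s' hA
    have hclear := agree_poke s' (e + 7) (0 : α)
    refine HaltsWithin.seq (.clear (post := (· = poke s' (e + 7) (0 : α))) rfl) fun s'' hs'' =>
      .accumulate ?_
    subst hs''
    refine ⟨hclear.trans (agree_poke _ _ _), ?_⟩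
    rw [peek_poke, peek_poke, zero_add, hclear.peek (by omega), hA.peek (by omega),
      hA₁.peek (by omega)]
  have hsum := HaltsWithin.sumLoop (s := s₁) (N := b) (by simp [s₁]) fun _ _ s' hA _ => hcopy s' hA
  have hinit : HaltsWithin (.setNat natStack (.lit (e + 5)) (.get natStack (.lit (e + 1)))) s 1
      (· = s₁) := .setNat rfl
  refine (hinit.seq fun s' hs' => hs' ▸ hsum.seq fun s₂ ⟨hA₂, hv₂⟩ =>
    (HaltsWithin.clear (post := (· = poke s₂ e (0 : α))) rfl).seq fun s₃ hs₃ =>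
      .accumulate ?_).mono (by omega) fun _ => id
  subst hs₃
  have hne : e + 4 ≠ e := by omega
  refine ⟨(((hA₁.mono (by omega)).trans (hA₂.mono (by omega))).trans (agree_poke s₂ e _)).trans
    (agree_poke _ e _), fun i hi hi' => ?_, ?_⟩
  · rw [poke_nat _ _ hi.ne', poke_nat _ _ hi.ne', hA₂.nat i hi', hA₁.nat i hi']
  · rw [peek_poke, peek_poke, zero_add, peek_congr (poke_nat _ _ hne) (poke_real _ _ hne), hv₂,
      Finset.sum_const, Finset.card_range]

/-- Multiply the value in the cell `e` by the number in the cell `e + 1`, as often as the cell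
`e + 2` says. -/
def powLoop (α : Type) [AddCommMonoid α] [LinearOrder α] [StackValue α] (e : ℕ) : Program :=
  forLoop (e + 3) (e + 2) (scale α e)

theorem HaltsWithin.powLoop {s : State} {e b g : ℕ} (hb : s.nat natStack (e + 1) = b)
    (hg : s.nat natStack (e + 2) = g) :
    HaltsWithin (powLoop α e) s (g * (b * 5 + 8) + 2) fun s' =>
      Agree e s s' ∧ peek s' e = b ^ g • (peek s e : α) := by
  set I : ℕ → State → Prop := fun k s' => Agree e s s' ∧ s'.nat natStack (e + 1) = b ∧
    peek s' e = b ^ k • (peek s e : α) ∧ s'.nat natStack (e + 3) = k ∧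
    s'.nat natStack (e + 2) = g
  refine (HaltsWithin.forLoop (N := g) (I := I) (τ := b * 5 + 6) (fun k s' hI => hI.2.2.2) ?_
    fun k _ s₁ ⟨hA, hb₁, hv, hc, hg₁⟩ => ?_).mono (le_of_eq (by ring))
    fun s' hI => ⟨hI.1, hI.2.2.1⟩
  · have hA := Agree.writeNat s 0 (le_refl (e + 3))
    exact ⟨hA.mono (by omega), by simp [hb], by simp [hA.peek (show e < e + 3 by omega)], by simp,
      by simp [hg]⟩
  · refine (HaltsWithin.scale (α := α) s₁ e).mono (by rw [hb₁]) fun s₂ ⟨hA₂, hn, hv₂⟩ => ?_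
    have hA₃ := Agree.writeNat s₂ (k + 1) (le_refl (e + 3))
    refine ⟨by rw [hn _ (by omega) (by omega), hc], (hA.trans hA₂).trans (hA₃.mono (by omega)), ?_,
      ?_, by simp, ?_⟩
    · rw [hA₃.nat _ (by omega), hn _ (by omega) (by omega), hb₁]
    · rw [hA₃.peek (by omega), hv₂, hv, hb₁, smul_smul, pow_succ']
    · rw [hA₃.nat _ (by omega), hn _ (by omega) (by omega), hg₁]

end StackValues

section Computability

open StackValue

variable {α : Type} [AddCommMonoid α] [LinearOrder α] [StackValue α] {d : ℕ}

theorem eval_mono (p : Polynomial ℕ) : Monotone fun x => p.eval x := fun x y h => by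
  simp only [Polynomial.eval_eq_sum_range]
  gcongr

/-- The argument of the polynomials that bound the running time of a computation with the natural
variables `v`. -/
def State.sizeWith (s : State) (v : Fin d → ℕ) : ℕ := s.size + ∑ i, v i

theorem State.sizeWith_snoc (s : State) (v : Fin d → ℕ) (x : ℕ) :
    s.sizeWith (Fin.snoc (α := fun _ => ℕ) v x) = s.sizeWith v + x := by
  simp [State.sizeWith, Fin.sum_univ_castSucc, add_assoc]

theorem State.vars_snoc (s : State) (loc : Fin d → ℕ) (c : ℕ) :
    s.vars (Fin.snoc (α := fun _ => ℕ) loc c) =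
      Fin.snoc (α := fun _ => ℕ) (s.vars loc) (s.nat natStack c) := by
  funext i
  refine Fin.lastCases ?_ (fun i => ?_) i <;> simp [State.vars]

/-- With its variables in the cells `loc i`, the program `P` puts the value `f` into the stack
cell `e`, without touching the cells below `e`, in time bounded by the polynomial `p`. -/
def Computes (P : Program) (p : Polynomial ℕ) (loc : Fin d → ℕ) (e : ℕ)
    (f : State → (Fin d → ℕ) → α) : Prop :=
  ∀ s, HaltsWithin P s (p.eval (s.sizeWith (s.vars loc))) fun s' =>
    Agree e s s' ∧ peek s' e = f s.clean (s.vars loc)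

/-- A value that depends on the memory and on `d` natural variables can be computed in polynomial
time, wherever the variables are placed on the stack. -/
def PolyComputable (f : State → (Fin d → ℕ) → α) : Prop :=
  ∀ (loc : Fin d → ℕ) (e : ℕ), (∀ i, loc i < e) → ∃ P p, Computes P p loc e f

/-- A number that can be computed and bounded in polynomial time, so that a loop may run up to
it. -/
def PolyBounded (g : State → (Fin d → ℕ) → ℕ) : Prop :=
  PolyComputable g ∧ ∃ q : Polynomial ℕ, ∀ M v, g M v ≤ q.eval (M.sizeWith v)

open Classical in
/-- A property of the memory and of `d` natural variables can be decided in polynomial time. -/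
def PolyDecidable (q : State → (Fin d → ℕ) → Prop) : Prop :=
  PolyComputable fun M v => if q M v then 1 else 0

theorem Computes.after {P : Program} {p : Polynomial ℕ} {loc : Fin d → ℕ} {e e' : ℕ}
    {f : State → (Fin d → ℕ) → α} (h : Computes P p loc e f) (hl : ∀ i, loc i < e')
    {s s' : State} (hA : Agree e' s s') :
    HaltsWithin P s' (p.eval (s.sizeWith (s.vars loc))) fun s'' =>
      Agree e s' s'' ∧ peek s'' e = f s.clean (s.vars loc) := by
  simpa only [State.sizeWith, hA.size, hA.vars hl, hA.clean] using h s'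

namespace PolyComputable

variable {β γ : Type} [AddCommMonoid β] [LinearOrder β] [StackValue β] [AddCommMonoid γ]
  [LinearOrder γ] [StackValue γ] {f : State → (Fin d → ℕ) → α}

theorem map (hf : PolyComputable f) (o : State → α → β) (R : ℕ → Program) (τ : ℕ)
    (hR : ∀ e s, HaltsWithin (R e) s τ fun s' => Agree e s s' ∧ peek s' e = o s.clean (peek s e)) :
    PolyComputable fun M v => o M (f M v) := by
  intro loc e hl
  obtain ⟨P, p, hP⟩ := hf loc e hl
  refine ⟨.seq P (R e), p + Polynomial.C τ, fun s => ?_⟩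
  rw [Polynomial.eval_add, Polynomial.eval_C]
  refine (hP s).seq fun s₁ ⟨hA, hv⟩ => (hR e s₁).mono le_rfl fun s₂ ⟨hA', hv'⟩ => ?_
  exact ⟨hA.trans hA', by rw [hv', hv, hA.clean]⟩

theorem map₂ {g : State → (Fin d → ℕ) → β} (hf : PolyComputable f) (hg : PolyComputable g)
    (o : α → β → γ) (R : ℕ → Program) (τ : ℕ)
    (hR : ∀ e s, HaltsWithin (R e) s τ fun s' =>
      Agree e s s' ∧ peek s' e = o (peek s e) (peek s (e + 1))) :
    PolyComputable fun M v => o (f M v) (g M v) := by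
  intro loc e hl
  obtain ⟨P, p, hP⟩ := hf loc e hl
  obtain ⟨Q, q, hQ⟩ := hg loc (e + 1) fun i => (hl i).trans e.lt_succ_self
  refine ⟨.seq P (.seq Q (R e)), p + (q + Polynomial.C τ), fun s => ?_⟩
  simp only [Polynomial.eval_add, Polynomial.eval_C]
  refine (hP s).seq fun s₁ ⟨hA, hv⟩ => (hQ.after hl hA).seq fun s₂ ⟨hA', hv'⟩ =>
    (hR e s₂).mono le_rfl fun s₃ ⟨hA'', hv''⟩ => ?_
  exact ⟨(hA.trans (hA'.mono e.le_succ)).trans hA'',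
    by rw [hv'', hA'.peek e.lt_succ_self, hv, hv']⟩

theorem lit (c : ℕ) : PolyComputable (d := d) fun _ _ => c := fun _ e _ =>
  ⟨.setNat natStack (.lit e) (.lit c), 1, fun s => by
    rw [Polynomial.eval_one]
    exact .setNat ⟨.writeNat s _ le_rfl, peek_poke s e c⟩⟩

theorem zero : PolyComputable (d := d) fun _ _ => (0 : α) := fun _ e _ =>
  ⟨clear α e, 1, fun s => by
    rw [Polynomial.eval_one]
    exact .clear ⟨agree_poke s e 0, peek_poke s e 0⟩⟩

theorem var (i : Fin d) : PolyComputable fun _ v => v i := fun loc e _ =>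
  ⟨.setNat natStack (.lit e) (.get natStack (.lit (loc i))), 1, fun s => by
    rw [Polynomial.eval_one]
    exact .setNat ⟨.writeNat s _ le_rfl, peek_poke s e (s.nat natStack (loc i))⟩⟩

theorem rename {d' : ℕ} (σ : Fin d → Fin d') (hf : PolyComputable f) :
    PolyComputable fun M v => f M fun i => v (σ i) := by
  intro loc e hl
  obtain ⟨P, p, hP⟩ := hf (fun i => loc (σ i)) e fun i => hl (σ i)
  refine ⟨P, p.comp (Polynomial.C (d + 1) * Polynomial.X), fun s => (hP s).mono ?_ fun _ => id⟩
  rw [Polynomial.eval_comp, Polynomial.eval_mul, Polynomial.eval_C, Polynomial.eval_X]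
  refine eval_mono p ?_
  have hsum : ∑ i, s.vars loc (σ i) ≤ d * ∑ i, s.vars loc i := by
    simpa using Finset.sum_le_card_nsmul Finset.univ (fun i => s.vars loc (σ i)) _ fun i _ =>
      Finset.single_le_sum (fun _ _ => Nat.zero_le _) (Finset.mem_univ (σ i))
  exact (Nat.add_le_add (Nat.le_mul_of_pos_left _ d.succ_pos)
    (hsum.trans (Nat.mul_le_mul_right _ d.le_succ))).trans_eq (Nat.mul_add _ _ _).symm

theorem natGet {a : ℕ} (ha : a ≠ natStack) {g : State → (Fin d → ℕ) → ℕ} (hg : PolyComputable g) :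
    PolyComputable fun M v => M.nat a (g M v) :=
  hg.map (fun M x => M.nat a x)
    (fun e => .setNat natStack (.lit e) (.get a (.get natStack (.lit e)))) 1 fun e s =>
    .setNat ⟨.writeNat s _ le_rfl, (peek_poke s e _).trans (s.clean_nat ha _).symm⟩

theorem realGet {a : ℕ} (ha : a ≠ realStack) {g : State → (Fin d → ℕ) → ℕ}
    (hg : PolyComputable g) : PolyComputable fun M v => M.real a (g M v) :=
  hg.map (fun M x => M.real a x)
    (fun e => .setReal realStack (.lit e) (.get a (.get natStack (.lit e)))) 1 fun e s =>
    .setReal ⟨.writeReal s _ le_rfl, (peek_poke s e _).trans (s.clean_real ha _).symm⟩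

theorem add {g : State → (Fin d → ℕ) → α} (hf : PolyComputable f) (hg : PolyComputable g) :
    PolyComputable fun M v => f M v + g M v :=
  hf.map₂ hg (· + ·) (fun e => accumulate α e (e + 1)) 1 fun e s =>
    .accumulate ⟨agree_poke s e _, peek_poke s e _⟩

theorem sub {f g : State → (Fin d → ℕ) → ℕ} (hf : PolyComputable f) (hg : PolyComputable g) :
    PolyComputable fun M v => f M v - g M v :=
  hf.map₂ hg (· - ·) (fun e => .setNat natStack (.lit e)
    (.sub (.get natStack (.lit e)) (.get natStack (.lit (e + 1))))) 1 fun e s =>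
    .setNat ⟨.writeNat s _ le_rfl, peek_poke s e _⟩

theorem ite {q : State → (Fin d → ℕ) → Prop} [∀ M v, Decidable (q M v)]
    {g : State → (Fin d → ℕ) → α} (hq : PolyDecidable q) (hf : PolyComputable f)
    (hg : PolyComputable g) : PolyComputable fun M v => if q M v then f M v else g M v := by
  intro loc e hl
  obtain ⟨P, p, hP⟩ := hq loc e hl
  obtain ⟨Q, q', hQ⟩ := hf loc e hl
  obtain ⟨R, r, hR⟩ := hg loc e hl
  refine ⟨.seq P (.branch (.natLt (.lit 0) (.get natStack (.lit e))) Q R), p + (q' + r + 1),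
    fun s => ?_⟩
  simp only [Polynomial.eval_add, Polynomial.eval_one]
  refine (hP s).seq fun s₁ ⟨hA, hv⟩ => ?_
  have hholds :
      (Test.natLt (.lit 0) (.get natStack (.lit e))).Holds s₁ ↔ q s.clean (s.vars loc) := by
    change 0 < (peek s₁ e : ℕ) ↔ _
    rw [hv]
    dsimp only
    split_ifs with h <;> simp [h]
  refine .branch (fun h => ?_) fun h => ?_ <;> rw [hholds] at h
  · exact (hQ.after hl hA).mono (Nat.le_add_right _ _) fun s₂ h' =>
      ⟨hA.trans h'.1, by rw [h'.2, if_pos h]⟩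
  · exact (hR.after hl hA).mono (Nat.le_add_left _ _) fun s₂ h' =>
      ⟨hA.trans h'.1, by rw [h'.2, if_neg h]⟩

theorem sum {g : State → (Fin d → ℕ) → ℕ} {f : State → (Fin d → ℕ) → ℕ → α}
    (hg : PolyBounded g)
    (hf : PolyComputable fun M (v : Fin (d + 1) → ℕ) =>
      f M (fun i => v i.castSucc) (v (Fin.last d))) :
    PolyComputable fun M v => ∑ x ∈ Finset.range (g M v), f M v x := by
  intro loc e hl
  have hl' : ∀ i, loc i < e + 1 := fun i => (hl i).trans e.lt_succ_self
  obtain ⟨hg, q, hq⟩ := hg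
  obtain ⟨G, r, hG⟩ := hg loc (e + 1) hl'
  obtain ⟨F, p, hF⟩ := hf (Fin.snoc (α := fun _ => ℕ) loc (e + 2)) (e + 3) fun i => by
    refine Fin.lastCases (by simp) (fun i => ?_) i
    simpa using (hl i).trans (by omega)
  refine ⟨.seq G (sumLoop α e F), r + (q * (p.comp (.X + q) + 3) + 3), fun s => ?_⟩
  have hN : g s.clean (s.vars loc) ≤ q.eval (s.sizeWith (s.vars loc)) := hq s.clean _
  have hbody : ∀ k < g s.clean (s.vars loc), ∀ s', Agree e s s' → s'.nat natStack (e + 2) = k →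
      HaltsWithin F s' ((p.comp (.X + q)).eval (s.sizeWith (s.vars loc))) fun s'' =>
        Agree (e + 3) s' s'' ∧ peek s'' (e + 3) = f s.clean (s.vars loc) k := by
    intro k hk s' hA hc
    have hv : s'.vars (Fin.snoc (α := fun _ => ℕ) loc (e + 2)) =
        Fin.snoc (α := fun _ => ℕ) (s.vars loc) k := by rw [State.vars_snoc, hA.vars hl, hc]
    refine (hF s').mono ?_ fun s'' h => ⟨h.1, by simpa [hv, hA.clean] using h.2⟩
    rw [hv, State.sizeWith_snoc, Polynomial.eval_comp, Polynomial.eval_add, Polynomial.eval_X]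
    refine eval_mono p (Nat.add_le_add ?_ (hk.le.trans hN))
    exact (congrArg (· + ∑ i, s.vars loc i) hA.size).le
  refine ((hG s).seq fun s' ⟨hA, hv⟩ =>
    (HaltsWithin.sumLoop hv fun k hk s'' hA' hc =>
      hbody k hk s'' ((hA.mono e.le_succ).trans hA') hc).mono le_rfl fun s'' ⟨hA', hv'⟩ =>
        ⟨(hA.mono e.le_succ).trans hA', hv'⟩).mono ?_ fun _ => id
  simp only [Polynomial.eval_add, Polynomial.eval_mul, Polynomial.eval_ofNat]
  gcongr

theorem weaken (hf : PolyComputable f) :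
    PolyComputable fun M (v : Fin (d + 1) → ℕ) => f M fun i => v i.castSucc :=
  hf.rename Fin.castSucc

theorem powSmul {b g : State → (Fin d → ℕ) → ℕ} (hb : PolyBounded b) (hg : PolyBounded g)
    (hf : PolyComputable f) : PolyComputable fun M v => b M v ^ g M v • f M v := by
  intro loc e hl
  obtain ⟨hb, qb, hqb⟩ := hb
  obtain ⟨hg, qg, hqg⟩ := hg
  obtain ⟨F, p, hF⟩ := hf loc e hl
  have hl₁ : ∀ i, loc i < e + 1 := fun i => (hl i).trans (by omega)
  have hl₂ : ∀ i, loc i < e + 2 := fun i => (hl i).trans (by omega)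
  obtain ⟨B, u, hB⟩ := hb loc (e + 1) hl₁
  obtain ⟨G, r, hG⟩ := hg loc (e + 2) hl₂
  refine ⟨.seq F (.seq B (.seq G (powLoop α e))), p + (u + (r + (qg * (qb * 5 + 8) + 2))),
    fun s => ?_⟩
  simp only [Polynomial.eval_add, Polynomial.eval_mul, Polynomial.eval_ofNat]
  refine (hF s).seq fun s₁ ⟨hA₁, hv₁⟩ => (hB.after hl hA₁).seq fun s₂ ⟨hA₂, hv₂⟩ =>
    (hG.after hl (hA₁.trans (hA₂.mono e.le_succ))).seq fun s₃ ⟨hA₃, hv₃⟩ => ?_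
  have hv₂' : s₃.nat natStack (e + 1) = b s.clean (s.vars loc) :=
    (hA₃.nat _ (by omega)).trans hv₂
  refine (HaltsWithin.powLoop hv₂' hv₃).mono ?_ fun s₄ ⟨hA₄, hv₄⟩ =>
    ⟨((hA₁.trans (hA₂.mono (by omega))).trans (hA₃.mono (by omega))).trans hA₄, ?_⟩
  · gcongr
    · exact hqg s.clean _
    · exact hqb s.clean _
  · rw [hv₄, hA₃.peek (by omega), hA₂.peek (by omega), hv₁]

end PolyComputable

namespace PolyDecidable

variable {q r : State → (Fin d → ℕ) → Prop}

theorem of_indicator [∀ M v, Decidable (q M v)]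
    (h : PolyComputable fun M v => if q M v then 1 else 0) : PolyDecidable q := by
  unfold PolyDecidable
  convert h

theorem congr (hq : PolyDecidable q) (h : ∀ M v, q M v ↔ r M v) : PolyDecidable r := by
  rwa [← show q = r from funext₂ fun M v => propext (h M v)]

theorem lt {f g : State → (Fin d → ℕ) → α} (hf : PolyComputable f) (hg : PolyComputable g) :
    PolyDecidable fun M v => f M v < g M v := by
  classical
  refine of_indicator (hf.map₂ hg (fun x y => if x < y then 1 else 0) (fun e =>
    .branch (less α e (e + 1)) (.setNat natStack (.lit e) (.lit 1))
      (.setNat natStack (.lit e) (.lit 0))) 2 fun e s => .branch (fun h => ?_) fun h => ?_) <;>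
    rw [holds_less] at h
  · exact .setNat ⟨.writeNat s 1 le_rfl, (peek_poke s e 1).trans (if_pos h).symm⟩
  · exact .setNat ⟨.writeNat s 0 le_rfl, (peek_poke s e 0).trans (if_neg h).symm⟩

theorem not (hq : PolyDecidable q) : PolyDecidable fun M v => ¬ q M v := by
  classical
  refine .of_indicator ?_
  convert (PolyComputable.lit 1).sub hq using 3
  split_ifs <;> rfl

theorem and (hq : PolyDecidable q) (hr : PolyDecidable r) :
    PolyDecidable fun M v => q M v ∧ r M v := by
  classical
  refine .of_indicator ?_
  convert PolyComputable.ite hq hr (.lit 0) using 3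
  exact ite_and ..

theorem imp (hq : PolyDecidable q) (hr : PolyDecidable r) :
    PolyDecidable fun M v => q M v → r M v :=
  (hq.and hr.not).not.congr fun _ _ => by tauto

theorem le {f g : State → (Fin d → ℕ) → α} (hf : PolyComputable f) (hg : PolyComputable g) :
    PolyDecidable fun M v => f M v ≤ g M v := by
  simpa only [not_lt] using (lt hg hf).not

theorem eq {f g : State → (Fin d → ℕ) → α} (hf : PolyComputable f) (hg : PolyComputable g) :
    PolyDecidable fun M v => f M v = g M v := by
  simpa only [le_antisymm_iff] using (le hf hg).and (le hg hf)

theorem ne {f g : State → (Fin d → ℕ) → α} (hf : PolyComputable f) (hg : PolyComputable g) :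
    PolyDecidable fun M v => f M v ≠ g M v :=
  (eq hf hg).not

variable {g : State → (Fin d → ℕ) → ℕ} {q : State → (Fin d → ℕ) → ℕ → Prop}

theorem all (hg : PolyBounded g) (hq : PolyDecidable fun M (v : Fin (d + 1) → ℕ) =>
    q M (fun i => v i.castSucc) (v (Fin.last d))) :
    PolyDecidable fun M v => ∀ x < g M v, q M v x := by
  classical
  have h := eq (PolyComputable.sum (f := fun M v x => if ¬ q M v x then 1 else 0) hg
    (.ite hq.not (.lit 1) (.lit 0))) (.lit 0)
  simpa only [Finset.sum_eq_zero_iff, Finset.mem_range, ite_eq_right_iff, one_ne_zero, imp_false,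
    not_not] using h

theorem ex (hg : PolyBounded g) (hq : PolyDecidable fun M (v : Fin (d + 1) → ℕ) =>
    q M (fun i => v i.castSucc) (v (Fin.last d))) :
    PolyDecidable fun M v => ∃ x < g M v, q M v x := by
  simpa only [not_forall, not_not, exists_prop] using
    (all (q := fun M v x => ¬ q M v x) hg hq.not).not

end PolyDecidable

/-- The least `x < L` with property `q`, or `L` if there is none. -/
noncomputable def first (L : ℕ) (q : ℕ → Prop) : ℕ := sInf {x | L ≤ x ∨ q x}

theorem first_le_limit (L : ℕ) (q : ℕ → Prop) : first L q ≤ L := Nat.sInf_le (.inl le_rfl)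

theorem first_le {x : ℕ} (L : ℕ) {q : ℕ → Prop} (h : q x) : first L q ≤ x := Nat.sInf_le (.inr h)

theorem first_of_lt {L : ℕ} {q : ℕ → Prop} (h : first L q < L) : q (first L q) :=
  (Nat.sInf_mem (s := {x | L ≤ x ∨ q x}) ⟨L, .inl le_rfl⟩).resolve_left h.not_ge

theorem first_spec {L : ℕ} {q : ℕ → Prop} (h : ∃ x < L, q x) :
    first L q < L ∧ q (first L q) := by
  obtain ⟨x, hx, hqx⟩ := h
  have hlt := (first_le L hqx).trans_lt hx
  exact ⟨hlt, first_of_lt hlt⟩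

theorem lt_first_iff {L x : ℕ} {q : ℕ → Prop} (hx : x < L) :
    x < first L q ↔ ∀ y < x + 1, ¬ q y := by
  refine ⟨fun h y hy hq => ((first_le L hq).trans (Nat.le_of_lt_succ hy)).not_gt h, fun h => ?_⟩
  by_contra! hle
  exact h _ (Nat.lt_succ_of_le hle) (first_of_lt (hle.trans_lt hx))

open Classical in
theorem first_eq_sum (L : ℕ) (q : ℕ → Prop) :
    first L q = ∑ x ∈ Finset.range L, if ∀ y < x + 1, ¬ q y then 1 else 0 := by
  have hfilter : {x ∈ Finset.range L | ∀ y < x + 1, ¬ q y} = Finset.range (first L q) := by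
    ext x
    rw [Finset.mem_filter, Finset.mem_range, Finset.mem_range]
    exact ⟨fun h => (lt_first_iff h.1).2 h.2, fun h =>
      have hx := h.trans_le (first_le_limit L q)
      ⟨hx, (lt_first_iff hx).1 h⟩⟩
  rw [← Finset.sum_filter, hfilter, Finset.sum_const, Finset.card_range, smul_eq_mul, mul_one]

theorem first_eq_clog (n : ℕ) : first (n + 1) (fun m => n ≤ 2 ^ m) = Nat.clog 2 n := by
  refine (first_le (x := Nat.clog 2 n) _ (Nat.le_pow_clog one_lt_two n)).antisymm
    (Nat.clog_le_of_le_pow ?_)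
  exact (first_spec (q := fun m => n ≤ 2 ^ m) ⟨n, n.lt_succ_self, n.lt_two_pow_self.le⟩).2

theorem two_pow_clog_le (n : ℕ) : 2 ^ Nat.clog 2 n ≤ 2 * n + 1 := by
  rcases Nat.lt_or_ge 1 n with hn | hn
  · obtain ⟨m, hm⟩ := Nat.exists_eq_add_one.2 (Nat.clog_pos one_lt_two hn)
    have hlt : 2 ^ m < n := (Nat.lt_clog_iff_pow_lt one_lt_two).1 (by omega)
    rw [hm, pow_succ]
    omega
  · rw [Nat.clog_of_right_le_one hn]
    omega

namespace PolyBounded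

variable {f g : State → (Fin d → ℕ) → ℕ}

theorem of_le (hg : PolyBounded g) (hf : PolyComputable f) (h : ∀ M v, f M v ≤ g M v) :
    PolyBounded f :=
  ⟨hf, hg.2.imp fun _ hq M v => (h M v).trans (hq M v)⟩

theorem lit (c : ℕ) : PolyBounded (d := d) fun _ _ => c :=
  ⟨.lit c, .C c, fun _ _ => by rw [Polynomial.eval_C]⟩

theorem var (i : Fin d) : PolyBounded fun _ v => v i :=
  ⟨.var i, .X, fun _ v => by
    rw [Polynomial.eval_X]
    exact (Finset.single_le_sum (fun _ _ => Nat.zero_le _) (Finset.mem_univ i)).trans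
      (Nat.le_add_left _ _)⟩

theorem size : PolyBounded (d := d) fun M _ => M.size :=
  ⟨.natGet (by decide) (.lit 0), .X, fun _ _ => by
    rw [Polynomial.eval_X]
    exact Nat.le_add_right _ _⟩

theorem add (hf : PolyBounded f) (hg : PolyBounded g) : PolyBounded fun M v => f M v + g M v := by
  obtain ⟨hf, p, hp⟩ := hf
  obtain ⟨hg, q, hq⟩ := hg
  refine ⟨hf.add hg, p + q, fun M v => ?_⟩
  rw [Polynomial.eval_add]
  exact Nat.add_le_add (hp M v) (hq M v)

theorem sub (hf : PolyBounded f) (hg : PolyBounded g) : PolyBounded fun M v => f M v - g M v :=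
  hf.of_le (hf.1.sub hg.1) fun _ _ => Nat.sub_le _ _

theorem constMul (c : ℕ) (hf : PolyBounded f) : PolyBounded fun M v => c * f M v := by
  obtain ⟨h, p, hp⟩ := hf
  refine ⟨by simpa using (PolyComputable.powSmul (.lit c) (.lit 1) h), .C c * p, fun M v => ?_⟩
  rw [Polynomial.eval_mul, Polynomial.eval_C]
  exact Nat.mul_le_mul_left c (hp M v)

theorem weaken (hf : PolyBounded f) :
    PolyBounded fun M (v : Fin (d + 1) → ℕ) => f M fun i => v i.castSucc := by
  obtain ⟨hf, p, hp⟩ := hf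
  refine ⟨hf.weaken, p, fun M v => (hp M _).trans (eval_mono p ?_)⟩
  simp [State.sizeWith, Fin.sum_univ_castSucc]

theorem count {q : State → (Fin d → ℕ) → ℕ → Prop} [∀ M v, DecidablePred (q M v)]
    (hg : PolyBounded g)
    (hq : PolyDecidable fun M (v : Fin (d + 1) → ℕ) =>
      q M (fun i => v i.castSucc) (v (Fin.last d))) :
    PolyBounded fun M v => ((Finset.range (g M v)).filter (q M v)).card := by
  refine hg.of_le ?_ fun M v => (Finset.card_filter_le _ _).trans_eq (Finset.card_range _)
  simp only [Finset.card_filter]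
  exact .sum hg (.ite hq (.lit 1) (.lit 0))

theorem first {q : State → (Fin d → ℕ) → ℕ → Prop} (hg : PolyBounded g)
    (hq : PolyDecidable fun M (v : Fin (d + 1) → ℕ) =>
      q M (fun i => v i.castSucc) (v (Fin.last d))) :
    PolyBounded fun M v => first (g M v) (q M v) := by
  classical
  refine hg.of_le ?_ fun _ _ => first_le_limit _ _
  simp only [first_eq_sum]
  have hq' : PolyDecidable fun M (v : Fin (d + 2) → ℕ) =>
      q M (fun i => v i.castSucc.castSucc) (v (Fin.last (d + 1))) := by
    have h := PolyComputable.rename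
      (Fin.snoc (α := fun _ => Fin (d + 2)) (fun i => i.castSucc.castSucc) (Fin.last (d + 1))) hq
    simp only [Fin.snoc_castSucc, Fin.snoc_last] at h
    exact h
  exact .sum hg (.ite (.all (q := fun M v y => ¬ q M (fun i => v i.castSucc) y)
    ((PolyBounded.var (Fin.last d)).add (.lit 1)) hq'.not) (.lit 1) (.lit 0))

theorem clog_size : PolyBounded (d := d) fun M _ => Nat.clog 2 M.size := by
  have h : PolyBounded (d := d) fun M _ => RealRAM.first (M.size + 1) fun m => M.size ≤ 2 ^ m := by
    refine .first (size.add (.lit 1)) (.le size.1 ?_)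
    simpa using PolyComputable.powSmul (.lit 2) (.var (Fin.last d)) (.lit 1)
  refine h.of_le (by simpa only [first_eq_clog] using h.1) fun M _ => ?_
  rw [first_eq_clog]

theorem two_pow_clog_size (k : ℕ) :
    PolyBounded (d := d) fun M _ => 2 ^ (k * Nat.clog 2 M.size) := by
  refine ⟨by simpa using PolyComputable.powSmul (.lit 2) (clog_size.constMul k) (.lit 1),
    (2 * .X + 1) ^ k, fun M v => ?_⟩
  simp only [Polynomial.eval_pow, Polynomial.eval_add, Polynomial.eval_mul, Polynomial.eval_ofNat,
    Polynomial.eval_X, Polynomial.eval_one]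
  rw [mul_comm, pow_mul]
  gcongr
  refine (two_pow_clog_le M.size).trans ?_
  gcongr
  exact Nat.le_add_right _ _

end PolyBounded

end Computability

section Filling

/-- Fill the first `m` cells of the array `A` one after the other. -/
def fillTo (A : ℕ) (f : State → ℕ → ℕ) (M : State) : ℕ → State
  | 0 => M
  | k + 1 => (fillTo A f M k).writeNat A k (f (fillTo A f M k) k)

/-- Fill an initial segment of the array `A` whose length is a function of the input size. -/
def fill (len : ℕ → ℕ) (A : ℕ) (f : State → ℕ → ℕ) (M : State) : State :=
  fillTo A f M (len M.size)

/-- Memory transformations that a program carries out in polynomial time, up to the contents of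
the evaluation stacks. -/
def Performs (φ : State → State) : Prop :=
  ∃ (P : Program) (p : Polynomial ℕ), ∀ s : State, HaltsWithin P s (p.eval s.size) fun s' =>
    s'.clean = φ s.clean ∧ s'.size = s.size

variable {len : ℕ → ℕ} {A a k m m' : ℕ}

theorem Performs.skip : Performs fun M => M :=
  ⟨.skip, 1, fun s => by
    rw [Polynomial.eval_one]
    exact .of_exec (.skip s) ⟨rfl, rfl⟩⟩

theorem Performs.comp {φ ψ : State → State} (hφ : Performs φ) (hψ : Performs ψ) :
    Performs fun M => ψ (φ M) := by
  obtain ⟨P, p, hP⟩ := hφ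
  obtain ⟨Q, q, hQ⟩ := hψ
  refine ⟨.seq P Q, p + q, fun s => ?_⟩
  rw [Polynomial.eval_add]
  refine (hP s).seq fun s' ⟨hc, hs⟩ => ?_
  dsimp only
  rw [← hs, ← hc]
  exact hQ s'

theorem fillTo_nat_of_ne (h : a ≠ A) (f : State → ℕ → ℕ) (M : State) (m : ℕ) :
    (fillTo A f M m).nat a = M.nat a := by
  induction m with
  | zero => rfl
  | succ m ih => funext i; simp [fillTo, h, ih]

theorem fillTo_size (hA₀ : A ≠ 0) (f : State → ℕ → ℕ) (M : State) (m : ℕ) :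
    (fillTo A f M m).size = M.size := congrFun (fillTo_nat_of_ne hA₀.symm f M m) 0

theorem fillTo_real (A : ℕ) (f : State → ℕ → ℕ) (M : State) (m : ℕ) :
    (fillTo A f M m).real = M.real := by
  induction m with
  | zero => rfl
  | succ m ih => simp [fillTo, ih]

theorem fillTo_nat_of_lt (h : k < m) (h' : m ≤ m') (f : State → ℕ → ℕ) (M : State) :
    (fillTo A f M m').nat A k = (fillTo A f M m).nat A k := by
  induction m', h' using Nat.le_induction with
  | base => rfl
  | succ m' hm ih => simp [fillTo, (h.trans_le hm).ne, ih]

theorem fill_nat {f : State → ℕ → ℕ} {M : State} (hk : k < len M.size)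
    (hf : ∀ M' M'' : State, M'.real = M''.real → (∀ a, a ≠ A → M'.nat a = M''.nat a) →
      (∀ j < k, M'.nat A j = M''.nat A j) → f M' k = f M'' k) :
    (fill len A f M).nat A k = f (fill len A f M) k := by
  unfold fill
  rw [fillTo_nat_of_lt k.lt_succ_self hk]
  simp only [fillTo, State.writeNat_nat, and_self, if_true]
  refine hf _ _ (by rw [fillTo_real, fillTo_real])
    (fun a ha => by rw [fillTo_nat_of_ne ha, fillTo_nat_of_ne ha]) fun j hj => ?_
  rw [fillTo_nat_of_lt j.lt_succ_self hj, fillTo_nat_of_lt j.lt_succ_self (hj.trans hk)]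

theorem performs_fill (hlen : PolyBounded (d := 0) fun M _ => len M.size) (hA : A ≠ natStack)
    (hA₀ : A ≠ 0) {f : State → ℕ → ℕ}
    (hf : PolyComputable fun M (v : Fin 1 → ℕ) => f M (v 0)) : Performs (fill len A f) := by
  obtain ⟨hlen, q, hq⟩ := hlen
  obtain ⟨Q, r, hQ⟩ := hlen Fin.elim0 0 fun i => i.elim0
  obtain ⟨P, p, hP⟩ := hf (fun _ => 1) 2 fun _ => one_lt_two
  have hsize k (s s' : State) (h : s'.clean = fillTo A f s.clean k) : s'.size = s.size := by
    rw [← s'.size_clean, h, fillTo_size hA₀, s.size_clean]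
  refine ⟨.seq Q (forLoop 1 0 (.seq P
    (.setNat A (.get natStack (.lit 1)) (.get natStack (.lit 2))))),
    r + (q * (p.comp (.X + q) + 1 + 2) + 2), fun s => ?_⟩
  simp only [Polynomial.eval_add, Polynomial.eval_mul, Polynomial.eval_comp, Polynomial.eval_X,
    Polynomial.eval_ofNat, Polynomial.eval_one]
  have hsum₀ : s.sizeWith (s.vars Fin.elim0) = s.size := by simp [State.sizeWith]
  have hlen_le : len s.size ≤ q.eval s.size := by simpa [hsum₀] using hq s (s.vars Fin.elim0)
  set I : ℕ → State → Prop := fun k s' => s'.clean = fillTo A f s.clean k ∧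
    s'.nat natStack 1 = k ∧ s'.nat natStack 0 = len s.size
  have hstep : ∀ k < len s.size, ∀ s₁, I k s₁ →
      HaltsWithin (.seq P (.setNat A (.get natStack (.lit 1)) (.get natStack (.lit 2)))) s₁
        (p.eval (s.size + q.eval s.size) + 1) fun s₂ =>
          s₂.nat natStack 1 = k ∧ I (k + 1) (s₂.writeNat natStack 1 (k + 1)) := by
    rintro k hk s₁ ⟨hc, hcount, hlimit⟩
    refine ((hP s₁).mono (eval_mono p ?_) fun _ => id).seq fun s₂ ⟨hAg, hv⟩ => .setNat ?_
    · rw [State.sizeWith, hsize k s s₁ hc]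
      simpa [State.vars, hcount] using hk.le.trans hlen_le
    · have hv' : s₂.nat natStack 2 = f (fillTo A f s.clean k) k :=
        hv.trans (by simp only [State.vars, hcount, hc])
      simp [I, NatExpr.eval, State.clean_writeNat _ hA, hA.symm, hAg.clean, hAg.nat, hc, hcount,
        hlimit, hv', fillTo]
  refine ((hQ s).seq fun s₁ ⟨hAg, hv⟩ => (HaltsWithin.forLoop (I := I) (N := len s.size)
    (fun k s' hI => hI.2) ?_ hstep).mono le_rfl fun s' hI => ⟨hI.1, hsize _ s s' hI.1⟩).mono ?_
      fun _ => id
  · exact ⟨by simp [fillTo, hAg.clean], by simp, (by simp : _ = s₁.nat natStack 0).trans hv⟩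
  · rw [hsum₀]
    gcongr

end Filling

/-- An array, the rule by which its cells are filled one after the other, and the arrays that the
rule reads. -/
structure Stage where
  target : ℕ
  reads : List ℕ
  rule : State → ℕ → ℕ

namespace Stage

/-- The rule depends on natural arrays only through those that it is supposed to read and through
the cells of its own array that have been filled before. -/
def Local (σ : Stage) : Prop :=
  ∀ (M N : State) (k : ℕ), M.real = N.real → (∀ a ∈ σ.reads, M.nat a = N.nat a) →
    (∀ j < k, M.nat σ.target j = N.nat σ.target j) → σ.rule M k = σ.rule N k

/-- The array has been filled according to the rule. -/
def Solved (len : ℕ → ℕ) (σ : Stage) (M : State) : Prop :=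
  ∀ k < len M.size, M.nat σ.target k = σ.rule M k

/-- Carry out several stages one after the other. -/
def run (len : ℕ → ℕ) : List Stage → State → State
  | [], M => M
  | σ :: l, M => run len l (fill len σ.target σ.rule M)

variable {len : ℕ → ℕ} {l : List Stage}

theorem run_real (l : List Stage) (M : State) : (run len l M).real = M.real := by
  induction l generalizing M with
  | nil => rfl
  | cons σ l ih => rw [run, ih, fill, fillTo_real]

theorem run_nat {a : ℕ} (h : ∀ σ ∈ l, a ≠ σ.target) (M : State) :
    (run len l M).nat a = M.nat a := by
  induction l generalizing M with
  | nil => rfl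
  | cons σ l ih =>
    rw [run, ih fun σ hσ => h σ (.tail _ hσ), fill, fillTo_nat_of_ne (h σ (.head _))]

theorem run_size (h : ∀ σ ∈ l, 0 ≠ σ.target) (M : State) : (run len l M).size = M.size := by
  rw [State.size, run_nat h, State.size]

theorem solved_run_cons {σ : Stage} (hσ : σ.Local) (hread : σ.target ∉ σ.reads)
    (h₀ : ∀ τ ∈ σ :: l, 0 ≠ τ.target) (hl : ∀ τ ∈ l, τ.target ∉ σ.target :: σ.reads) (M : State) :
    σ.Solved len (run len (σ :: l) M) := by
  intro k hk
  rw [run_size h₀] at hk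
  have hrun : ∀ a ∈ σ.target :: σ.reads,
      (run len l (fill len σ.target σ.rule M)).nat a = (fill len σ.target σ.rule M).nat a :=
    fun a ha => run_nat (fun τ hτ heq => hl τ hτ (heq ▸ ha)) _
  rw [run, hrun _ (.head _), fill_nat hk]
  · exact hσ _ _ _ (run_real _ _).symm (fun a ha => (hrun a (.tail _ ha)).symm) fun j _ =>
      congrFun (hrun _ (.head _)).symm j
  · exact fun M' M'' hr hn hj => hσ _ _ _ hr (fun a ha => hn a fun heq => hread (heq ▸ ha)) hj

theorem solved_run (hlocal : ∀ σ ∈ l, σ.Local) (hread : ∀ σ ∈ l, σ.target ∉ σ.reads)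
    (h₀ : ∀ σ ∈ l, 0 ≠ σ.target)
    (hp : l.Pairwise fun σ τ => τ.target ∉ σ.target :: σ.reads) (M : State) :
    ∀ σ ∈ l, σ.Solved len (run len l M) := by
  induction l generalizing M with
  | nil => simp
  | cons τ l ih =>
    rw [List.pairwise_cons] at hp
    intro σ hσ
    rcases List.mem_cons.1 hσ with rfl | hσ
    · exact solved_run_cons (hlocal σ (.head _)) (hread σ (.head _)) h₀ hp.1 M
    · exact ih (fun σ hσ => hlocal σ (.tail _ hσ)) (fun σ hσ => hread σ (.tail _ hσ))
        (fun σ hσ => h₀ σ (.tail _ hσ)) hp.2 _ σ hσ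

theorem performs_run (h : ∀ σ ∈ l, Performs (fill len σ.target σ.rule)) :
    Performs (run len l) := by
  induction l with
  | nil => exact .skip
  | cons σ l ih => exact (h σ (.head _)).comp (ih fun σ hσ => h σ (.tail _ hσ))

end Stage

end RealRAM

/-! ## The algorithm -/

open RealRAM (first first_spec first_of_lt first_le)

/-- Boxes given by arrays of coordinates and weights, of which the first `n` entries count. -/
structure BoxData where
  n : ℕ
  l : ℕ → ℝ
  r : ℕ → ℝ
  b : ℕ → ℝ
  t : ℕ → ℝ
  w : ℕ → ℝ

namespace BoxData

/-- The boxes are nonempty and have positive weights. -/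
structure Valid (X : BoxData) : Prop where
  l_le_r : ∀ i < X.n, X.l i ≤ X.r i
  b_le_t : ∀ i < X.n, X.b i ≤ X.t i
  w_pos : ∀ i < X.n, 0 < X.w i

/-- The grid points, given by pairs `(a, c)`: the first coordinate is the left coordinate of box
`a`, the second one the bottom coordinate of box `c`. -/
def grid (X : BoxData) : Finset (ℕ × ℕ) := Finset.range X.n ×ˢ Finset.range X.n

/-- Box `i` contains the grid point given by `a` and `c`. -/
def Covers (X : BoxData) (i a c : ℕ) : Prop :=
  i < X.n ∧ X.l i ≤ X.l a ∧ X.l a ≤ X.r i ∧ X.b i ≤ X.b c ∧ X.b c ≤ X.t i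

/-- Box `i` crosses box `j` vertically, in the weak sense: it is not wider and not shorter. -/
def Prec (X : BoxData) (i j : ℕ) : Prop :=
  X.l j ≤ X.l i ∧ X.r i ≤ X.r j ∧ X.b i ≤ X.b j ∧ X.t j ≤ X.t i

/-- Box `i` crosses box `j` vertically and is not equal to it. -/
def SPrec (X : BoxData) (i j : ℕ) : Prop := X.Prec i j ∧ ¬ X.Prec j i

/-- Boxes `i` and `j` intersect. -/
def Meets (X : BoxData) (i j : ℕ) : Prop :=
  X.l i ≤ X.r j ∧ X.l j ≤ X.r i ∧ X.b i ≤ X.t j ∧ X.b j ≤ X.t i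

/-- Boxes `i` and `j` intersect, but do not cross. -/
def Conflict (X : BoxData) (i j : ℕ) : Prop :=
  X.Meets i j ∧ ¬ X.SPrec i j ∧ ¬ X.SPrec j i

open Classical in
/-- The number of boxes among `e 0, …, e (k - 1)` that contain a grid point. -/
noncomputable def load (X : BoxData) (e : ℕ → ℕ) (k a c : ℕ) : ℕ :=
  {j ∈ Finset.range k | X.Covers (e j) a c}.card

/-- The total price of the grid points, where a point of load `m` costs `2 ^ m`. -/
noncomputable def totalPrice (X : BoxData) (e : ℕ → ℕ) (k : ℕ) : ℕ :=
  ∑ p ∈ X.grid, 2 ^ X.load e k p.1 p.2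

open Classical in
/-- The total price of the grid points in box `i`. -/
noncomputable def price (X : BoxData) (e : ℕ → ℕ) (k i : ℕ) : ℕ :=
  ∑ p ∈ X.grid, if X.Covers i p.1 p.2 then 2 ^ X.load e k p.1 p.2 else 0

open Classical in
/-- The greedy choice after `e 0, …, e (k - 1)`: a box with the least price per weight, or the
invalid index `n` once the total price has reached `2 ^ T`. -/
noncomputable def pickRule (X : BoxData) (T : ℕ) (e : ℕ → ℕ) (k : ℕ) : ℕ :=
  if X.totalPrice e k < 2 ^ T then
    first X.n fun i => ∀ j < X.n, X.price e k i • X.w j ≤ X.price e k j • X.w i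
  else X.n

/-- Position `u` of the list `e` holds a box and does not occur among `ord 0, …, ord (k - 1)`. -/
def Remains (X : BoxData) (e ord : ℕ → ℕ) (k u : ℕ) : Prop :=
  e u < X.n ∧ ∀ j < k, ord j ≠ u

open Classical in
/-- The number of remaining positions of the list that are in conflict with position `v`. -/
noncomputable def conflictCount (X : BoxData) (L : ℕ) (e ord : ℕ → ℕ) (k v : ℕ) : ℕ :=
  {u ∈ Finset.range L | X.Remains e ord k u ∧ u ≠ v ∧ X.Conflict (e u) (e v)}.card

/-- The next position to be removed from a list of length `L`: one with at most `Q` conflicts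
among those that remain. -/
noncomputable def removeRule (X : BoxData) (L Q : ℕ) (e ord : ℕ → ℕ) (k : ℕ) : ℕ :=
  first L fun v => X.Remains e ord k v ∧ X.conflictCount L e ord k v ≤ Q

/-- The boxes in the order opposite to that of removal. -/
def reverseRule (X : BoxData) (L : ℕ) (e ord : ℕ → ℕ) (k : ℕ) : ℕ :=
  if ord (L - 1 - k) < L then e (ord (L - 1 - k)) else X.n

open Classical in
/-- The number of boxes of colour `z` among `e 0, …, e (k - 1)` that contain a grid point. -/
noncomputable def colorLoad (X : BoxData) (e col : ℕ → ℕ) (k a c z : ℕ) : ℕ :=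
  {j ∈ Finset.range k | X.Covers (e j) a c ∧ col j = z}.card

open Classical in
/-- Up to the factor `Q`, the amount by which the potential of the colouring grows when the box
`e k` receives the colour `z`. -/
noncomputable def colorCost (X : BoxData) (T Q : ℕ) (e col : ℕ → ℕ) (k z : ℕ) : ℕ :=
  ∑ p ∈ X.grid, if X.Covers (e k) p.1 p.2 then
    2 ^ (T - 1 - X.load e k p.1 p.2) * (Q + 1) ^ X.colorLoad e col k p.1 p.2 z else 0

/-- The colour of the next box, one of `2 * Q + 1` colours: it causes no conflict and does not
increase the potential. -/
noncomputable def colorRule (X : BoxData) (T Q : ℕ) (e col : ℕ → ℕ) (k : ℕ) : ℕ :=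
  first (2 * Q + 1) fun z =>
    (∀ j < k, e j < X.n → X.Conflict (e j) (e k) → col j ≠ z) ∧
      Q * X.colorCost T Q e col k z ≤ ∑ y ∈ Finset.range (2 * Q + 1), X.colorCost T Q e col k y

open Classical in
/-- The number of boxes of the same colour that cross box `e k` vertically and whose projections
contain the left coordinate of box `a`. -/
noncomputable def crossings (X : BoxData) (L : ℕ) (e col : ℕ → ℕ) (k a : ℕ) : ℕ :=
  {j ∈ Finset.range L | e j < X.n ∧ col j = col k ∧ X.SPrec (e j) (e k) ∧
    X.l (e j) ≤ X.l a ∧ X.l a ≤ X.r (e j)}.card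

/-- The maximal number of vertical crossings over a point of the horizontal projection. -/
noncomputable def levelRule (X : BoxData) (L : ℕ) (e col : ℕ → ℕ) (k : ℕ) : ℕ :=
  first L fun h => ∀ a < X.n, X.l (e k) ≤ X.l a → X.l a ≤ X.r (e k) →
    X.crossings L e col k a ≤ h

open Classical in
/-- The total weight of the boxes of given colour and level. -/
noncomputable def classWeight (X : BoxData) (L : ℕ) (e col lev : ℕ → ℕ) (z h : ℕ) : ℝ :=
  ∑ j ∈ Finset.range L, if e j < X.n ∧ col j = z ∧ lev j = h then X.w (e j) else 0

/-- No class with a colour below `C` and a level below `L` is heavier than that of colour `z` and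
level `h`. -/
def IsHeaviest (X : BoxData) (C L : ℕ) (e col lev : ℕ → ℕ) (z h : ℕ) : Prop :=
  ∀ z' < C, ∀ h' < L, X.classWeight L e col lev z' h' ≤ X.classWeight L e col lev z h

open Classical in
/-- Mark the boxes of the class of colour `z` and level `h`. -/
noncomputable def selectRule (L : ℕ) (e col lev : ℕ → ℕ) (z h i : ℕ) : ℕ :=
  if ∃ j < L, e j = i ∧ col j = z ∧ lev j = h then 1 else 0

end BoxData

/-! ## The greedy list -/

namespace BoxData

variable {X : BoxData} {L T k : ℕ} {e : ℕ → ℕ} {J : Finset ℕ}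

theorem mem_grid {p : ℕ × ℕ} : p ∈ X.grid ↔ p.1 < X.n ∧ p.2 < X.n := by simp [grid]

theorem Valid.covers_self (hX : X.Valid) {i : ℕ} (hi : i < X.n) : X.Covers i i i :=
  ⟨hi, le_rfl, hX.l_le_r i hi, le_rfl, hX.b_le_t i hi⟩

open Classical in
theorem load_succ (a c : ℕ) :
    X.load e (k + 1) a c = X.load e k a c + if X.Covers (e k) a c then 1 else 0 := by
  simp only [load, Finset.card_filter, Finset.sum_range_succ]

theorem totalPrice_succ : X.totalPrice e (k + 1) = X.totalPrice e k + X.price e k (e k) := by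
  rw [totalPrice, totalPrice, price, ← Finset.sum_add_distrib]
  refine Finset.sum_congr rfl fun p _ => ?_
  rw [load_succ]
  split_ifs
  · rw [pow_succ, mul_two]
  · rfl

theorem price_pos (hX : X.Valid) {i : ℕ} (hi : i < X.n) : 0 < X.price e k i := by
  classical
  refine Finset.sum_pos' (fun _ _ => Nat.zero_le _) ⟨(i, i), mem_grid.2 ⟨hi, hi⟩, ?_⟩
  rw [if_pos (hX.covers_self hi)]
  positivity

open Classical in
/-- The weight of the boxes listed at the first `k` positions. -/
noncomputable def listWeight (X : BoxData) (e : ℕ → ℕ) (k : ℕ) : ℝ :=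
  ∑ j ∈ Finset.range k, if e j < X.n then X.w (e j) else 0

/-- The boxes in `J` have no grid points in common. -/
structure IsPacking (X : BoxData) (J : Finset ℕ) : Prop where
  lt_n : ∀ i ∈ J, i < X.n
  disjoint : ∀ i ∈ J, ∀ j ∈ J, i ≠ j → ∀ a c, X.Covers i a c → ¬ X.Covers j a c

theorem IsPacking.sum_price_le (hJ : X.IsPacking J) :
    ∑ i ∈ J, X.price e k i ≤ X.totalPrice e k := by
  classical
  unfold price totalPrice
  rw [Finset.sum_comm]
  refine Finset.sum_le_sum fun p _ => ?_
  by_cases hp : ∃ i ∈ J, X.Covers i p.1 p.2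
  · obtain ⟨i, hi, hc⟩ := hp
    rw [Finset.sum_eq_single_of_mem i hi fun j hj hji =>
      if_neg (hJ.disjoint i hi j hj hji.symm _ _ hc), if_pos hc]
  · rw [Finset.sum_eq_zero fun i hi => if_neg fun hc => hp ⟨i, hi, hc⟩]
    exact Nat.zero_le _

/-- `e` lists the boxes picked by the greedy rule. -/
def IsGreedy (X : BoxData) (L T : ℕ) (e : ℕ → ℕ) : Prop := ∀ k < L, e k = X.pickRule T e k

namespace IsGreedy

theorem totalPrice_lt (h : X.IsGreedy L T e) (hk : k < L) (he : e k < X.n) :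
    X.totalPrice e k < 2 ^ T := by
  rw [h k hk, pickRule] at he
  by_contra hc
  exact (he.trans_eq (if_neg hc).symm).ne rfl

theorem load_le (h : X.IsGreedy L T e) (hk : k ≤ L) {p : ℕ × ℕ} (hp : p ∈ X.grid) :
    X.load e k p.1 p.2 ≤ T := by
  induction k with
  | zero => simp [load]
  | succ k ih =>
    rw [load_succ]
    split_ifs with hc
    · have hpoint : 2 ^ X.load e k p.1 p.2 ≤ X.totalPrice e k :=
        Finset.single_le_sum (f := fun p => 2 ^ X.load e k p.1 p.2) (fun _ _ => Nat.zero_le _) hp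
      exact (Nat.pow_lt_pow_iff_right one_lt_two).1 (hpoint.trans_lt (h.totalPrice_lt hk hc.1))
    · exact ih (by omega)

theorem pick_spec (h : X.IsGreedy L T e) (hX : X.Valid) (hk : k < L) (hn : 0 < X.n)
    (hlt : X.totalPrice e k < 2 ^ T) :
    e k < X.n ∧ ∀ j < X.n, X.price e k (e k) * X.w j ≤ X.price e k j * X.w (e k) := by
  obtain ⟨i, hi, hmin⟩ := Finset.exists_min_image (Finset.range X.n)
    (fun i => (X.price e k i : ℝ) / X.w i) ⟨0, Finset.mem_range.2 hn⟩
  rw [Finset.mem_range] at hi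
  have hbest : ∃ i < X.n, ∀ j < X.n, X.price e k i • X.w j ≤ X.price e k j • X.w i := by
    refine ⟨i, hi, fun j hj => ?_⟩
    have hij := hmin j (Finset.mem_range.2 hj)
    rwa [div_le_div_iff₀ (hX.w_pos i hi) (hX.w_pos j hj), ← nsmul_eq_mul, ← nsmul_eq_mul] at hij
  have hpick := first_spec hbest
  have hek := h k hk
  rw [pickRule, if_pos hlt] at hek
  rw [← hek] at hpick
  simpa only [nsmul_eq_mul] using hpick

theorem two_pow_le_totalPrice (h : X.IsGreedy L T e) (hX : X.Valid) (hn : 0 < X.n)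
    (hL : 2 ^ T ≤ L) : 2 ^ T ≤ X.totalPrice e L := by
  suffices key : ∀ k ≤ L, k ≤ X.totalPrice e k ∨ 2 ^ T ≤ X.totalPrice e k from
    (key L le_rfl).elim hL.trans id
  intro k hk
  induction k with
  | zero => exact .inl (Nat.zero_le _)
  | succ k ih =>
    rw [totalPrice_succ]
    rcases lt_or_ge (X.totalPrice e k) (2 ^ T) with hlt | hge
    · have hpos : 0 < X.price e k (e k) := price_pos hX (h.pick_spec hX hk hn hlt).1
      exact (ih (by omega)).imp (by omega) (by omega)
    · exact .inr (hge.trans (Nat.le_add_right _ _))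

/- The greedy rule is compared with an average over the packing. -/
theorem price_mul_sum_le (h : X.IsGreedy L T e) (hX : X.Valid) (hJ : X.IsPacking J) (hk : k < L)
    (he : e k < X.n) :
    X.price e k (e k) * ∑ i ∈ J, X.w i ≤ X.totalPrice e k * X.w (e k) := by
  have hpick := (h.pick_spec hX hk (by omega) (h.totalPrice_lt hk he)).2
  calc X.price e k (e k) * ∑ i ∈ J, X.w i
      = ∑ i ∈ J, X.price e k (e k) * X.w i := Finset.mul_sum ..
    _ ≤ ∑ i ∈ J, X.price e k i * X.w (e k) := Finset.sum_le_sum fun i hi => hpick i (hJ.lt_n i hi)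
    _ = (∑ i ∈ J, X.price e k i : ℕ) * X.w (e k) := by rw [Nat.cast_sum, Finset.sum_mul]
    _ ≤ X.totalPrice e k * X.w (e k) := by
      gcongr
      · exact (hX.w_pos _ he).le
      · exact hJ.sum_price_le

theorem totalPrice_le_exp (h : X.IsGreedy L T e) (hX : X.Valid) (hJ : X.IsPacking J)
    (hO : 0 < ∑ i ∈ J, X.w i) (hk : k ≤ L) :
    (X.totalPrice e k : ℝ) ≤ X.n ^ 2 * Real.exp (X.listWeight e k / ∑ i ∈ J, X.w i) := by
  induction k with
  | zero => simp [totalPrice, load, listWeight, grid, sq]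
  | succ k ih =>
    specialize ih (by omega)
    rw [totalPrice_succ, listWeight, Finset.sum_range_succ, ← listWeight, Nat.cast_add]
    by_cases he : e k < X.n
    · rw [if_pos he, add_div, Real.exp_add, ← mul_assoc]
      have hprice : (X.price e k (e k) : ℝ) ≤
          X.totalPrice e k * (X.w (e k) / ∑ i ∈ J, X.w i) := by
        rw [← mul_div_assoc, le_div_iff₀ hO]
        exact h.price_mul_sum_le hX hJ hk he
      calc (X.totalPrice e k : ℝ) + X.price e k (e k)
          ≤ X.totalPrice e k * (X.w (e k) / ∑ i ∈ J, X.w i + 1) := by linarith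
        _ ≤ X.totalPrice e k * Real.exp (X.w (e k) / ∑ i ∈ J, X.w i) := by
          gcongr
          exact Real.add_one_le_exp _
        _ ≤ _ := by gcongr
    · have hzero : X.price e k (e k) = 0 :=
        Finset.sum_eq_zero fun p _ => if_neg fun hc => he hc.1
      simpa [he, hzero] using ih

theorem listWeight_nonneg (hX : X.Valid) : 0 ≤ X.listWeight e k :=
  Finset.sum_nonneg fun j _ => by
    split_ifs with hj
    · exact (hX.w_pos _ hj).le
    · exact le_rfl

theorem mul_sum_le_listWeight {ℓ : ℕ} (h : X.IsGreedy L (4 * ℓ) e) (hX : X.Valid)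
    (hL : 2 ^ (4 * ℓ) ≤ L) (hℓ : X.n ≤ 2 ^ ℓ) (hJ : X.IsPacking J) :
    ℓ * ∑ i ∈ J, X.w i ≤ X.listWeight e L := by
  rcases J.eq_empty_or_nonempty with rfl | ⟨i, hi⟩
  · simpa using listWeight_nonneg hX
  have hO : 0 < ∑ i ∈ J, X.w i :=
    Finset.sum_pos (fun i hi => hX.w_pos i (hJ.lt_n i hi)) ⟨i, hi⟩
  set E := Real.exp (X.listWeight e L / ∑ i ∈ J, X.w i) with hE
  have hbudget : (2 : ℝ) ^ (2 * ℓ) * 2 ^ (2 * ℓ) ≤ 2 ^ (2 * ℓ) * E :=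
    calc (2 : ℝ) ^ (2 * ℓ) * 2 ^ (2 * ℓ) = 2 ^ (4 * ℓ) := by ring
      _ ≤ X.totalPrice e L := by
        exact_mod_cast h.two_pow_le_totalPrice hX ((Nat.zero_le i).trans_lt (hJ.lt_n i hi)) hL
      _ ≤ X.n ^ 2 * E := h.totalPrice_le_exp hX hJ hO le_rfl
      _ ≤ (2 ^ ℓ) ^ 2 * E := by gcongr; exact_mod_cast hℓ
      _ = 2 ^ (2 * ℓ) * E := by ring
  have hlog := Real.log_le_log (by positivity) (le_of_mul_le_mul_left hbudget (by positivity))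
  rw [hE, Real.log_exp, Real.log_pow, le_div_iff₀ hO] at hlog
  refine le_trans (mul_le_mul_of_nonneg_right ?_ hO.le) hlog
  have := Real.log_two_gt_d9
  push_cast
  nlinarith [(Nat.cast_nonneg ℓ : (0 : ℝ) ≤ ℓ)]

end IsGreedy

end BoxData

/-! ## Degeneracy of the conflict graph -/

namespace BoxData

variable {X : BoxData} {L T Q k : ℕ} {e ord s : ℕ → ℕ}

/-- Box `i` contains the point `p` of the plane. -/
def Inside (X : BoxData) (i : ℕ) (p : ℝ × ℝ) : Prop :=
  X.l i ≤ p.1 ∧ p.1 ≤ X.r i ∧ X.b i ≤ p.2 ∧ p.2 ≤ X.t i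

/-- The four corners of a box: `q` tells whether to take the left and the bottom side. -/
def corner (X : BoxData) (i : ℕ) (q : Bool × Bool) : ℝ × ℝ :=
  (if q.1 then X.l i else X.r i, if q.2 then X.b i else X.t i)

theorem Conflict.exists_inside_corner {i j : ℕ} (h : X.Conflict i j) :
    (∃ q, X.Inside i (X.corner j q)) ∨ ∃ q, X.Inside j (X.corner i q) := by
  obtain ⟨hmeets, hij, hji⟩ := h
  simp only [Meets, SPrec, Prec] at hmeets hij hji
  simp only [Inside, corner, Prod.exists, Bool.exists_bool, if_true, Bool.false_eq_true, if_false]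
  by_contra hc
  push Not at hc
  grind

/- The point may be moved left and down to the nearest sides of boxes that contain it: this leads
to a grid point in the same boxes. -/
open Classical in
theorem card_inside_le {V : Finset ℕ} (hV : ∀ v ∈ V, e v < X.n)
    (hT : ∀ p ∈ X.grid, {v ∈ V | X.Covers (e v) p.1 p.2}.card ≤ T) (p : ℝ × ℝ) :
    {v ∈ V | X.Inside (e v) p}.card ≤ T := by
  rcases {v ∈ V | X.Inside (e v) p}.eq_empty_or_nonempty with hempty | hne
  · simp [hempty]
  obtain ⟨a, ha, hleft⟩ := Finset.exists_max_image _ (fun v => X.l (e v)) hne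
  obtain ⟨c, hc, hbottom⟩ := Finset.exists_max_image _ (fun v => X.b (e v)) hne
  rw [Finset.mem_filter] at ha hc
  refine le_trans (Finset.card_le_card fun v hv => ?_)
    (hT (e a, e c) (mem_grid.2 ⟨hV a ha.1, hV c hc.1⟩))
  have hal := hleft v hv
  have hcb := hbottom v hv
  rw [Finset.mem_filter] at hv ⊢
  exact ⟨hv.1, hV v hv.1, hal, ha.2.1.trans hv.2.2.1, hcb, hc.2.2.2.1.trans hv.2.2.2.2⟩

open Classical in
theorem card_inside_corner_le {V : Finset ℕ} (hV : ∀ v ∈ V, e v < X.n)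
    (hT : ∀ p ∈ X.grid, {v ∈ V | X.Covers (e v) p.1 p.2}.card ≤ T) (i : ℕ) :
    {u ∈ V | ∃ q, X.Inside (e u) (X.corner i q)}.card ≤ 4 * T :=
  calc {u ∈ V | ∃ q, X.Inside (e u) (X.corner i q)}.card
      ≤ (Finset.univ.biUnion fun q => {u ∈ V | X.Inside (e u) (X.corner i q)}).card := by
        refine Finset.card_le_card fun u hu => ?_
        obtain ⟨huV, q, hq⟩ := Finset.mem_filter.1 hu
        exact Finset.mem_biUnion.2 ⟨q, Finset.mem_univ q, Finset.mem_filter.2 ⟨huV, hq⟩⟩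
    _ ≤ (Finset.univ : Finset (Bool × Bool)).card * T :=
        Finset.card_biUnion_le_card_mul _ _ _ fun q _ => card_inside_le hV hT _
    _ = 4 * T := by simp

/- Double counting: each conflict is charged to a box one of whose corners lies in the other box,
and each box is charged at most `4 * T` times. -/
open Classical in
theorem exists_card_conflict_le {V : Finset ℕ} (hV : ∀ v ∈ V, e v < X.n) (hne : V.Nonempty)
    (hT : ∀ p ∈ X.grid, {v ∈ V | X.Covers (e v) p.1 p.2}.card ≤ T) :
    ∃ v ∈ V, {u ∈ V | X.Conflict (e u) (e v)}.card ≤ 8 * T := by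
  refine Finset.exists_le_of_sum_le (g := fun _ => 8 * T) hne ?_
  set A : ℕ → ℕ → Prop := fun u v => ∃ q, X.Inside (e u) (X.corner (e v) q)
  have hsymm : ∑ v ∈ V, {u ∈ V | A v u}.card = ∑ v ∈ V, {u ∈ V | A u v}.card := by
    simp only [Finset.card_filter]
    exact Finset.sum_comm
  calc ∑ v ∈ V, {u ∈ V | X.Conflict (e u) (e v)}.card
      ≤ ∑ v ∈ V, ({u ∈ V | A u v}.card + {u ∈ V | A v u}.card) := by
        refine Finset.sum_le_sum fun v _ => le_trans (Finset.card_le_card ?_)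
          (Finset.card_union_le _ _)
        rw [← Finset.filter_or]
        exact Finset.monotone_filter_right V fun u _ hu => hu.exists_inside_corner
    _ = ∑ v ∈ V, ({u ∈ V | A u v}.card + {u ∈ V | A u v}.card) := by
        rw [Finset.sum_add_distrib, hsymm, Finset.sum_add_distrib]
    _ ≤ ∑ v ∈ V, 8 * T := Finset.sum_le_sum fun v _ => by
        have : {u ∈ V | A u v}.card ≤ 4 * T := card_inside_corner_le hV hT (e v)
        omega

open Classical in
/-- The conflict graph of the boxes listed by `e` is `Q`-degenerate. -/
def IsDegenerate (X : BoxData) (L Q : ℕ) (e : ℕ → ℕ) : Prop :=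
  ∀ V ⊆ Finset.range L, (∀ v ∈ V, e v < X.n) → V.Nonempty →
    ∃ v ∈ V, {u ∈ V | X.Conflict (e u) (e v)}.card ≤ Q

open Classical in
theorem isDegenerate_of_load_le (h : ∀ p ∈ X.grid, X.load e L p.1 p.2 ≤ T) :
    X.IsDegenerate L (8 * T) e := fun _ hVL hV hne =>
  exists_card_conflict_le hV hne fun p hp =>
    (Finset.card_le_card (Finset.filter_subset_filter _ hVL)).trans (h p hp)

/-- `ord` lists the positions of `e` in the order of removal. -/
def IsRemoval (X : BoxData) (L Q : ℕ) (e ord : ℕ → ℕ) : Prop :=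
  ∀ k < L, ord k = X.removeRule L Q e ord k

namespace IsRemoval

theorem spec (h : X.IsRemoval L Q e ord) (hk : k < L) (ho : ord k < L) :
    X.Remains e ord k (ord k) ∧ X.conflictCount L e ord k (ord k) ≤ Q := by
  have hrule := h k hk
  rw [removeRule] at hrule
  have hspec := first_of_lt (hrule ▸ ho)
  rwa [← hrule] at hspec

theorem ord_lt (h : X.IsRemoval L Q e ord) (hd : X.IsDegenerate L Q e) (hk : k < L) {v : ℕ}
    (hv : v < L) (hr : X.Remains e ord k v) : ord k < L := by
  classical
  obtain ⟨u, hu, hcard⟩ := hd {u ∈ Finset.range L | X.Remains e ord k u}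
    (Finset.filter_subset _ _) (fun u hu => (Finset.mem_filter.1 hu).2.1)
    ⟨v, Finset.mem_filter.2 ⟨Finset.mem_range.2 hv, hr⟩⟩
  rw [Finset.mem_filter, Finset.mem_range] at hu
  rw [h k hk]
  refine (first_spec ⟨u, hu.1, hu.2, (Finset.card_le_card fun x hx => ?_).trans hcard⟩).1
  simp only [Finset.mem_filter] at hx ⊢
  exact ⟨⟨hx.1, hx.2.1⟩, hx.2.2.2⟩

theorem ord_ne (h : X.IsRemoval L Q e ord) {j : ℕ} (hjk : j < k) (hk : k < L)
    (ho : ord k < L) : ord j ≠ ord k :=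
  (h.spec hk ho).1.2 j hjk

theorem ord_inj (h : X.IsRemoval L Q e ord) {j : ℕ} (hj : j < L) (hk : k < L)
    (ho : ord k < L) (hjk : ord j = ord k) : j = k := by
  rcases lt_trichotomy j k with hlt | heq | hgt
  · exact absurd hjk (h.ord_ne hlt hk ho)
  · exact heq
  · exact absurd hjk.symm (h.ord_ne hgt hj (hjk ▸ ho))

/- Otherwise `v` remains until the end, and the `L` positions removed are distinct elements of the
set of the other `L - 1` positions. -/
theorem exists_ord_eq (h : X.IsRemoval L Q e ord) (hd : X.IsDegenerate L Q e) {v : ℕ} (hv : v < L)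
    (hev : e v < X.n) : ∃ k < L, ord k = v := by
  by_contra! hc
  have hlt : ∀ k < L, ord k < L := fun k hk =>
    h.ord_lt hd hk hv ⟨hev, fun j hj => hc j (hj.trans hk)⟩
  have hcard : (Finset.range L).card ≤ ((Finset.range L).erase v).card := by
    refine Finset.card_le_card_of_injOn ord (fun k hk => ?_) fun j hj k hk hjk => ?_
    · rw [Finset.mem_coe, Finset.mem_range] at hk
      exact Finset.mem_coe.2 (Finset.mem_erase.2 ⟨hc k hk, Finset.mem_range.2 (hlt k hk)⟩)
    · rw [Finset.mem_coe, Finset.mem_range] at hj hk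
      exact h.ord_inj hj hk (hlt k hk) hjk
  rw [Finset.card_erase_of_mem (Finset.mem_range.2 hv), Finset.card_range] at hcard
  omega

end IsRemoval

/-- `s` lists the boxes of `e` in the order opposite to that of removal. -/
structure IsReversal (X : BoxData) (L Q : ℕ) (e ord s : ℕ → ℕ) : Prop where
  isRemoval : X.IsRemoval L Q e ord
  eq_rule : ∀ k < L, s k = X.reverseRule L e ord k

namespace IsReversal

theorem spec (h : X.IsReversal L Q e ord s) (hk : k < L) (hs : s k < X.n) :
    ord (L - 1 - k) < L ∧ s k = e (ord (L - 1 - k)) := by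
  have hrule := h.eq_rule k hk
  rw [reverseRule] at hrule
  split_ifs at hrule with ho
  · exact ⟨ho, hrule⟩
  · omega

theorem ord_inj (h : X.IsReversal L Q e ord s) {j : ℕ} (hj : j < L) (hk : k < L)
    (hs : s k < X.n) (hjk : ord (L - 1 - j) = ord (L - 1 - k)) : j = k := by
  have := h.isRemoval.ord_inj (j := L - 1 - j) (by omega) (by omega) (h.spec hk hs).1 hjk
  omega

theorem sum_eq {α : Type*} [AddCommMonoid α] (h : X.IsReversal L Q e ord s)
    (hd : X.IsDegenerate L Q e) (g : ℕ → α) :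
    (∑ k ∈ Finset.range L, if s k < X.n then g (s k) else 0) =
      ∑ k ∈ Finset.range L, if e k < X.n then g (e k) else 0 := by
  rw [← Finset.sum_filter, ← Finset.sum_filter]
  refine Finset.sum_bij (fun k _ => ord (L - 1 - k)) ?_ ?_ ?_ ?_
  · intro k hk
    rw [Finset.mem_filter, Finset.mem_range] at hk ⊢
    obtain ⟨ho, hsk⟩ := h.spec hk.1 hk.2
    exact ⟨ho, hsk ▸ hk.2⟩
  · intro j hj k hk hjk
    rw [Finset.mem_filter, Finset.mem_range] at hj hk
    exact h.ord_inj hj.1 hk.1 hk.2 hjk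
  · intro v hv
    rw [Finset.mem_filter, Finset.mem_range] at hv
    obtain ⟨k, hk, rfl⟩ := h.isRemoval.exists_ord_eq hd hv.1 hv.2
    have hrefl : L - 1 - (L - 1 - k) = k := by omega
    refine ⟨L - 1 - k, ?_, by simp only [hrefl]⟩
    rw [Finset.mem_filter, Finset.mem_range, h.eq_rule _ (by omega), reverseRule, hrefl,
      if_pos hv.1]
    exact ⟨by omega, hv.2⟩
  · intro k hk
    rw [Finset.mem_filter, Finset.mem_range] at hk
    rw [(h.spec hk.1 hk.2).2]

theorem listWeight_eq (h : X.IsReversal L Q e ord s) (hd : X.IsDegenerate L Q e) :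
    X.listWeight s L = X.listWeight e L :=
  h.sum_eq hd X.w

theorem load_eq (h : X.IsReversal L Q e ord s) (hd : X.IsDegenerate L Q e) (a c : ℕ) :
    X.load s L a c = X.load e L a c := by
  classical
  have hload (f : ℕ → ℕ) : X.load f L a c = ∑ k ∈ Finset.range L,
      if f k < X.n then (if X.Covers (f k) a c then 1 else 0) else 0 := by
    rw [load, Finset.card_filter]
    refine Finset.sum_congr rfl fun k _ => ?_
    rw [← ite_and]
    exact if_congr (and_iff_right_of_imp And.left).symm rfl rfl
  rw [hload, hload, h.sum_eq hd fun i => if X.Covers i a c then 1 else 0]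

open Classical in
theorem card_conflict_le (h : X.IsReversal L Q e ord s) (hk : k < L) (hs : s k < X.n) :
    {j ∈ Finset.range k | s j < X.n ∧ X.Conflict (s j) (s k)}.card ≤ Q := by
  obtain ⟨ho, hsk⟩ := h.spec hk hs
  refine le_trans ?_ (h.isRemoval.spec (k := L - 1 - k) (by omega) ho).2
  refine Finset.card_le_card_of_injOn (fun j => ord (L - 1 - j)) (fun j hj => ?_)
    fun i hi j hj hij => ?_
  · simp only [Finset.coe_filter, Finset.mem_range, Set.mem_ofPred_eq] at hj ⊢
    obtain ⟨ho', hsj⟩ := h.spec (hj.1.trans hk) hj.2.1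
    have hlt : L - 1 - k < L - 1 - j := by omega
    refine ⟨ho', ⟨hsj ▸ hj.2.1, fun i hi => ?_⟩, ?_, ?_⟩
    · exact h.isRemoval.ord_ne (hi.trans hlt) (by omega) ho'
    · exact (h.isRemoval.ord_ne hlt (by omega) ho').symm
    · rw [← hsj, ← hsk]
      exact hj.2.2
  · simp only [Finset.coe_filter, Finset.mem_range, Set.mem_ofPred_eq] at hi hj
    exact h.ord_inj (hi.1.trans hk) (hj.1.trans hk) hj.2.1 hij

end IsReversal

end BoxData

/-! ## Colours -/

namespace BoxData

variable {X : BoxData} {L T Q k : ℕ} {s col : ℕ → ℕ}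

open Classical in
theorem colorLoad_succ (a c z : ℕ) : X.colorLoad s col (k + 1) a c z =
    X.colorLoad s col k a c z + if X.Covers (s k) a c ∧ col k = z then 1 else 0 := by
  simp only [colorLoad, Finset.card_filter, Finset.sum_range_succ]

open Classical in
theorem colorLoad_le (a c z : ℕ) : X.colorLoad s col L a c z ≤ L :=
  (Finset.card_filter_le _ _).trans_eq (Finset.card_range L)

open Classical in
theorem load_mono {m : ℕ} (hkm : k ≤ m) (a c : ℕ) : X.load s k a c ≤ X.load s m a c :=
  Finset.card_le_card (Finset.filter_subset_filter _ (Finset.range_mono hkm))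

open Classical in
/-- `col` lists the colours that the colouring rule assigns to the boxes listed by `s`, a list of
depth at most `T` in which every box has at most `Q` conflicts with earlier ones. -/
structure IsColoring (X : BoxData) (L T Q : ℕ) (s col : ℕ → ℕ) : Prop where
  load_le : ∀ p ∈ X.grid, X.load s L p.1 p.2 ≤ T
  card_conflict_le : ∀ k < L, s k < X.n →
    {j ∈ Finset.range k | s j < X.n ∧ X.Conflict (s j) (s k)}.card ≤ Q
  eq_rule : ∀ k < L, col k = X.colorRule T Q s col k

/-- The share of a grid point in the potential, up to the factor that accounts for the load. -/
noncomputable def colorSum (X : BoxData) (Q : ℕ) (s col : ℕ → ℕ) (k : ℕ) (p : ℕ × ℕ) : ℕ :=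
  ∑ z ∈ Finset.range (2 * Q + 1), (Q + 1) ^ X.colorLoad s col k p.1 p.2 z

/-- The potential that governs the choice of the colours. A random colour that causes no conflict at
most doubles `colorSum` at a point of the box on average: the power of `2` pays for this. -/
noncomputable def potential (X : BoxData) (T Q : ℕ) (s col : ℕ → ℕ) (k : ℕ) : ℕ :=
  ∑ p ∈ X.grid, 2 ^ (T - X.load s k p.1 p.2) * X.colorSum Q s col k p

open Classical in
theorem sum_colorCost : ∑ z ∈ Finset.range (2 * Q + 1), X.colorCost T Q s col k z =
    ∑ p ∈ X.grid, if X.Covers (s k) p.1 p.2 then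
      2 ^ (T - 1 - X.load s k p.1 p.2) * X.colorSum Q s col k p else 0 := by
  simp only [colorCost, colorSum]
  rw [Finset.sum_comm]
  refine Finset.sum_congr rfl fun p _ => ?_
  split_ifs
  · rw [Finset.mul_sum]
  · exact Finset.sum_const_zero

open Classical in
theorem colorSum_succ (hz : col k < 2 * Q + 1) (p : ℕ × ℕ) :
    X.colorSum Q s col (k + 1) p = X.colorSum Q s col k p +
      if X.Covers (s k) p.1 p.2 then Q * (Q + 1) ^ X.colorLoad s col k p.1 p.2 (col k) else 0 := by
  unfold colorSum
  by_cases hc : X.Covers (s k) p.1 p.2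
  · have hterm : ∀ z, (Q + 1) ^ X.colorLoad s col (k + 1) p.1 p.2 z =
        (Q + 1) ^ X.colorLoad s col k p.1 p.2 z +
          if col k = z then Q * (Q + 1) ^ X.colorLoad s col k p.1 p.2 z else 0 := by
      intro z
      rw [colorLoad_succ]
      by_cases hz : col k = z
      · simp only [hc, hz, and_self, if_true, pow_succ]
        ring
      · simp [hz]
    simp only [hterm, Finset.sum_add_distrib, Finset.sum_ite_eq, Finset.mem_range, hz, if_true, hc]
  · simp [colorLoad_succ, hc]

theorem potential_zero :
    X.potential T Q s col 0 = X.n ^ 2 * (2 ^ T * (2 * Q + 1)) := by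
  simp [potential, colorSum, load, colorLoad, grid, sq]

namespace IsColoring

/- At most `Q` of the `2 * Q + 1` colours cause a conflict. If each of the others increased the
potential, then their costs alone would add up to more than the cost of all colours. -/
theorem spec (h : X.IsColoring L T Q s col) (hk : k < L) (hs : s k < X.n) :
    col k < 2 * Q + 1 ∧ (∀ j < k, s j < X.n → X.Conflict (s j) (s k) → col j ≠ col k) ∧
      Q * X.colorCost T Q s col k (col k) ≤
        ∑ y ∈ Finset.range (2 * Q + 1), X.colorCost T Q s col k y := by
  classical
  set V := {j ∈ Finset.range k | s j < X.n ∧ X.Conflict (s j) (s k)}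
  set Z := Finset.range (2 * Q + 1) \ V.image col with hZ
  have hZcard : Q ≤ Z.card ∧ 0 < Z.card := by
    have hsdiff : _ ≤ Z.card := Finset.le_card_sdiff (V.image col) (Finset.range (2 * Q + 1))
    have himage : (V.image col).card ≤ V.card := Finset.card_image_le
    have hVcard : V.card ≤ Q := h.card_conflict_le k hk hs
    rw [Finset.card_range] at hsdiff
    omega
  obtain ⟨z, hz, hcost⟩ : ∃ z ∈ Z, Q * X.colorCost T Q s col k z ≤
      ∑ y ∈ Finset.range (2 * Q + 1), X.colorCost T Q s col k y := by
    refine Finset.exists_le_of_sum_le (Finset.card_pos.1 hZcard.2) ?_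
    rw [← Finset.mul_sum, Finset.sum_const, smul_eq_mul]
    exact Nat.mul_le_mul hZcard.1 (Finset.sum_le_sum_of_subset Finset.sdiff_subset)
  rw [hZ, Finset.mem_sdiff, Finset.mem_range] at hz
  rw [h.eq_rule k hk]
  exact first_spec ⟨z, hz.1, fun j hjk hj hc heq => hz.2 (Finset.mem_image.2
    ⟨j, Finset.mem_filter.2 ⟨Finset.mem_range.2 hjk, hj, hc⟩, heq⟩), hcost⟩

theorem potential_succ_add (h : X.IsColoring L T Q s col) (hk : k < L) (hs : s k < X.n) :
    X.potential T Q s col (k + 1) + ∑ y ∈ Finset.range (2 * Q + 1), X.colorCost T Q s col k y =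
      X.potential T Q s col k + Q * X.colorCost T Q s col k (col k) := by
  rw [sum_colorCost, potential, potential, colorCost, Finset.mul_sum, ← Finset.sum_add_distrib,
    ← Finset.sum_add_distrib]
  refine Finset.sum_congr rfl fun p hp => ?_
  rw [colorSum_succ (h.spec hk hs).1, load_succ]
  by_cases hc : X.Covers (s k) p.1 p.2
  · have hload : X.load s (k + 1) p.1 p.2 ≤ T := (load_mono hk p.1 p.2).trans (h.load_le p hp)
    rw [load_succ, if_pos hc] at hload
    have hold : T - X.load s k p.1 p.2 = (T - 1 - X.load s k p.1 p.2) + 1 := by omega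
    have hnew : T - (X.load s k p.1 p.2 + 1) = T - 1 - X.load s k p.1 p.2 := by omega
    simp only [hc, if_true, hnew, hold, pow_succ]
    ring
  · simp [hc]

theorem potential_succ_le (h : X.IsColoring L T Q s col) (hk : k < L) :
    X.potential T Q s col (k + 1) ≤ X.potential T Q s col k := by
  by_cases hs : s k < X.n
  · have hadd := h.potential_succ_add hk hs
    have hcost := (h.spec hk hs).2.2
    omega
  · have hc (p : ℕ × ℕ) : ¬ X.Covers (s k) p.1 p.2 := fun hc => hs hc.1
    simp [potential, colorSum, load_succ, colorLoad_succ, hc]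

theorem potential_le (h : X.IsColoring L T Q s col) (hk : k ≤ L) :
    X.potential T Q s col k ≤ X.n ^ 2 * (2 ^ T * (2 * Q + 1)) := by
  induction k with
  | zero => exact potential_zero.le
  | succ k ih => exact (h.potential_succ_le hk).trans (ih (by omega))

theorem pow_colorLoad_le (h : X.IsColoring L T Q s col) {p : ℕ × ℕ} (hp : p ∈ X.grid) {z : ℕ}
    (hz : z < 2 * Q + 1) :
    (Q + 1) ^ X.colorLoad s col L p.1 p.2 z ≤ X.n ^ 2 * (2 ^ T * (2 * Q + 1)) :=
  calc (Q + 1) ^ X.colorLoad s col L p.1 p.2 z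
      ≤ X.colorSum Q s col L p :=
        Finset.single_le_sum (f := fun z => (Q + 1) ^ X.colorLoad s col L p.1 p.2 z)
          (fun _ _ => Nat.zero_le _) (Finset.mem_range.2 hz)
    _ ≤ 2 ^ (T - X.load s L p.1 p.2) * X.colorSum Q s col L p :=
        Nat.le_mul_of_pos_left _ (by positivity)
    _ ≤ X.potential T Q s col L :=
        Finset.single_le_sum (f := fun p => 2 ^ (T - X.load s L p.1 p.2) * X.colorSum Q s col L p)
          (fun _ _ => Nat.zero_le _) hp
    _ ≤ X.n ^ 2 * (2 ^ T * (2 * Q + 1)) := h.potential_le le_rfl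

end IsColoring

/-- The maximal number of boxes of the same colour that contain a common grid point. -/
noncomputable def colorDepth (X : BoxData) (L Q : ℕ) (s col : ℕ → ℕ) : ℕ :=
  (X.grid ×ˢ Finset.range (2 * Q + 1)).sup fun q => X.colorLoad s col L q.1.1 q.1.2 q.2

theorem colorLoad_le_colorDepth {p : ℕ × ℕ} (hp : p ∈ X.grid) {z : ℕ} (hz : z < 2 * Q + 1) :
    X.colorLoad s col L p.1 p.2 z ≤ X.colorDepth L Q s col :=
  Finset.le_sup (f := fun q : (ℕ × ℕ) × ℕ => X.colorLoad s col L q.1.1 q.1.2 q.2) (b := (p, z))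
    (Finset.mem_product.2 ⟨hp, Finset.mem_range.2 hz⟩)

theorem colorDepth_le : X.colorDepth L Q s col ≤ L := Finset.sup_le fun _ _ => colorLoad_le _ _ _

theorem IsColoring.pow_colorDepth_le (h : X.IsColoring L T Q s col) (hn : 0 < X.n) :
    (Q + 1) ^ X.colorDepth L Q s col ≤ X.n ^ 2 * (2 ^ T * (2 * Q + 1)) := by
  obtain ⟨q, hq, hdepth⟩ := Finset.exists_mem_eq_sup (X.grid ×ˢ Finset.range (2 * Q + 1))
    ⟨((0, 0), 0), by simp [grid, hn]⟩ fun q => X.colorLoad s col L q.1.1 q.1.2 q.2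
  rw [Finset.mem_product, Finset.mem_range] at hq
  rw [colorDepth, hdepth]
  exact h.pow_colorLoad_le hq.1 hq.2

end BoxData

/-! ## Levels -/

namespace BoxData

variable {X : BoxData} {L T Q D k : ℕ} {s col lev : ℕ → ℕ}

theorem Prec.trans {i j m : ℕ} (h : X.Prec i j) (h' : X.Prec j m) : X.Prec i m :=
  ⟨h'.1.trans h.1, h.2.1.trans h'.2.1, h.2.2.1.trans h'.2.2.1, h'.2.2.2.trans h.2.2.2⟩

theorem SPrec.trans {i j m : ℕ} (h : X.SPrec i j) (h' : X.SPrec j m) : X.SPrec i m :=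
  ⟨h.1.trans h'.1, fun hc => h'.2 (hc.trans h.1)⟩

theorem SPrec.irrefl (i : ℕ) : ¬ X.SPrec i i := fun h => h.2 h.1

open Classical in
theorem crossings_lt_colorLoad (hX : X.Valid) (hk : k < L) (hs : s k < X.n) {a : ℕ}
    (hleft : X.l (s k) ≤ X.l a) (hright : X.l a ≤ X.r (s k)) :
    X.crossings L s col k a < X.colorLoad s col L a (s k) (col k) := by
  have hb := hX.b_le_t _ hs
  refine Finset.card_lt_card ⟨fun j hj => ?_, fun hsub => ?_⟩
  · obtain ⟨hjL, hj, hcol, hprec, hl, hr⟩ := Finset.mem_filter.1 hj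
    exact Finset.mem_filter.2
      ⟨hjL, ⟨hj, hl, hr, hprec.1.2.2.1, hb.trans hprec.1.2.2.2⟩, hcol⟩
  · have hmem := hsub (Finset.mem_filter.2
      ⟨Finset.mem_range.2 hk, ⟨hs, hleft, hright, le_rfl, hb⟩, rfl⟩)
    exact SPrec.irrefl _ (Finset.mem_filter.1 hmem).2.2.2.1

open Classical in
theorem crossings_lt_crossings {j a : ℕ} (hj : j < L) (hs : s j < X.n) (hcol : col j = col k)
    (hprec : X.SPrec (s j) (s k)) (hleft : X.l (s j) ≤ X.l a) (hright : X.l a ≤ X.r (s j)) :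
    X.crossings L s col j a < X.crossings L s col k a := by
  refine Finset.card_lt_card ⟨fun i hi => ?_, fun hsub => ?_⟩
  · obtain ⟨hiL, hi, hcoli, hpreci, hlr⟩ := Finset.mem_filter.1 hi
    exact Finset.mem_filter.2 ⟨hiL, hi, hcoli.trans hcol, hpreci.trans hprec, hlr⟩
  · have hmem := hsub (Finset.mem_filter.2
      ⟨Finset.mem_range.2 hj, hs, hcol, hprec, hleft, hright⟩)
    exact SPrec.irrefl _ (Finset.mem_filter.1 hmem).2.2.2.1

/-- `lev` lists the levels of the boxes listed by `s`. -/
def IsLeveling (X : BoxData) (L : ℕ) (s col lev : ℕ → ℕ) : Prop :=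
  ∀ k < L, lev k = X.levelRule L s col k

namespace IsLeveling

theorem lt_of_crossings_lt (h : X.IsLeveling L s col lev) (hX : X.Valid) (hk : k < L)
    (hs : s k < X.n) (hcross : ∀ a < X.n, X.l (s k) ≤ X.l a → X.l a ≤ X.r (s k) →
      X.crossings L s col k a < D) : lev k < D := by
  have hD : 0 < D := (Nat.zero_le _).trans_lt (hcross (s k) hs le_rfl (hX.l_le_r _ hs))
  rw [h k hk]
  refine (first_le L (x := D - 1) fun a ha hl hr => ?_).trans_lt (by omega)
  have := hcross a ha hl hr
  omega

theorem crossings_le (h : X.IsLeveling L s col lev) (hX : X.Valid) (hk : k < L) (hs : s k < X.n)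
    {a : ℕ} (ha : a < X.n) (hleft : X.l (s k) ≤ X.l a) (hright : X.l a ≤ X.r (s k)) :
    X.crossings L s col k a ≤ lev k := by
  have hlt : lev k < L := h.lt_of_crossings_lt hX hk hs fun a _ hl hr =>
    (crossings_lt_colorLoad hX hk hs hl hr).trans_le (colorLoad_le _ _ _)
  have hrule := h k hk
  rw [levelRule] at hrule
  rw [hrule] at hlt ⊢
  exact first_of_lt hlt a ha hleft hright

theorem lt_of_sPrec (h : X.IsLeveling L s col lev) (hX : X.Valid) {j : ℕ} (hj : j < L)
    (hk : k < L) (hsj : s j < X.n) (hsk : s k < X.n) (hcol : col j = col k)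
    (hprec : X.SPrec (s j) (s k)) : lev j < lev k :=
  h.lt_of_crossings_lt hX hj hsj fun _ ha hl hr =>
    (crossings_lt_crossings hj hsj hcol hprec hl hr).trans_le
      (h.crossings_le hX hk hsk ha (hprec.1.1.trans hl) (hr.trans hprec.1.2.1))

theorem not_meets (h : X.IsLeveling L s col lev) (hcol : X.IsColoring L T Q s col) (hX : X.Valid)
    {j : ℕ} (hjk : j < k) (hk : k < L) (hsj : s j < X.n) (hsk : s k < X.n)
    (hc : col j = col k) (hl : lev j = lev k) : ¬ X.Meets (s j) (s k) := fun hm =>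
  have hj := hjk.trans hk
  (hcol.spec hk hsk).2.1 j hjk hsj
    ⟨hm, fun hp => (h.lt_of_sPrec hX hj hk hsj hsk hc hp).ne hl,
      fun hp => (h.lt_of_sPrec hX hk hj hsk hsj hc.symm hp).ne hl.symm⟩ hc

theorem lt_colorDepth (h : X.IsLeveling L s col lev) (hX : X.Valid) (hk : k < L) (hs : s k < X.n)
    (hz : col k < 2 * Q + 1) : lev k < X.colorDepth L Q s col :=
  h.lt_of_crossings_lt hX hk hs fun a ha hl hr =>
    (crossings_lt_colorLoad hX hk hs hl hr).trans_le
      (colorLoad_le_colorDepth (p := (a, s k)) (mem_grid.2 ⟨ha, hs⟩) hz)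

theorem listWeight_eq_sum (h : X.IsLeveling L s col lev) (hcol : X.IsColoring L T Q s col)
    (hX : X.Valid) : X.listWeight s L = ∑ z ∈ Finset.range (2 * Q + 1),
      ∑ m ∈ Finset.range (X.colorDepth L Q s col), X.classWeight L s col lev z m := by
  simp only [classWeight]
  rw [Finset.sum_congr rfl fun y _ => Finset.sum_comm, Finset.sum_comm, listWeight]
  refine Finset.sum_congr rfl fun k hk => ?_
  rw [Finset.mem_range] at hk
  by_cases hs : s k < X.n
  · have hz := (hcol.spec hk hs).1
    simp [hs, ite_and, hz, h.lt_colorDepth hX hk hs hz]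
  · simp [hs]

theorem listWeight_le (h : X.IsLeveling L s col lev) (hcol : X.IsColoring L T Q s col)
    (hX : X.Valid) {z m : ℕ} (hzm : X.IsHeaviest (2 * Q + 1) L s col lev z m) :
    X.listWeight s L ≤
      ((2 * Q + 1) * X.colorDepth L Q s col : ℕ) * X.classWeight L s col lev z m := by
  rw [h.listWeight_eq_sum hcol hX]
  calc _ ≤ ∑ _y ∈ Finset.range (2 * Q + 1), ∑ _x ∈ Finset.range (X.colorDepth L Q s col),
        X.classWeight L s col lev z m :=
        Finset.sum_le_sum fun _ hy => Finset.sum_le_sum fun _ hx =>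
          hzm _ (Finset.mem_range.1 hy) _ ((Finset.mem_range.1 hx).trans_le colorDepth_le)
    _ = _ := by
      simp only [Finset.sum_const, Finset.card_range, nsmul_eq_mul]
      push_cast
      ring

end IsLeveling

end BoxData

/-! ## Computability of the rules -/

namespace RealRAM

/-- The boxes described by the input arrays of a state. -/
def State.boxes (M : State) : BoxData :=
  ⟨M.nat 0 0, M.real 0, M.real 1, M.real 2, M.real 3, M.real 4⟩

variable {α : Type} [AddCommMonoid α] [LinearOrder α] [StackValue α] {d A C H : ℕ}
  {f g h i k L Q T : State → (Fin d → ℕ) → ℕ}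

theorem polyBounded_n : PolyBounded (d := d) fun M _ => M.boxes.n := .size

theorem polyComputable_l (hi : PolyComputable i) :
    PolyComputable fun M v => M.boxes.l (i M v) := .realGet (by decide) hi

theorem polyComputable_r (hi : PolyComputable i) :
    PolyComputable fun M v => M.boxes.r (i M v) := .realGet (by decide) hi

theorem polyComputable_b (hi : PolyComputable i) :
    PolyComputable fun M v => M.boxes.b (i M v) := .realGet (by decide) hi

theorem polyComputable_t (hi : PolyComputable i) :
    PolyComputable fun M v => M.boxes.t (i M v) := .realGet (by decide) hi

theorem polyComputable_w (hi : PolyComputable i) :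
    PolyComputable fun M v => M.boxes.w (i M v) := .realGet (by decide) hi

theorem polyDecidable_covers (hi : PolyComputable i) (hf : PolyComputable f)
    (hg : PolyComputable g) : PolyDecidable fun M v => M.boxes.Covers (i M v) (f M v) (g M v) :=
  (PolyDecidable.lt hi polyBounded_n.1).and <|
    (PolyDecidable.le (polyComputable_l hi) (polyComputable_l hf)).and <|
    (PolyDecidable.le (polyComputable_l hf) (polyComputable_r hi)).and <|
    (PolyDecidable.le (polyComputable_b hi) (polyComputable_b hg)).and
      (.le (polyComputable_b hg) (polyComputable_t hi))

theorem polyDecidable_prec (hf : PolyComputable f) (hg : PolyComputable g) :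
    PolyDecidable fun M v => M.boxes.Prec (f M v) (g M v) :=
  (PolyDecidable.le (polyComputable_l hg) (polyComputable_l hf)).and <|
    (PolyDecidable.le (polyComputable_r hf) (polyComputable_r hg)).and <|
    (PolyDecidable.le (polyComputable_b hf) (polyComputable_b hg)).and
      (.le (polyComputable_t hg) (polyComputable_t hf))

theorem polyDecidable_sPrec (hf : PolyComputable f) (hg : PolyComputable g) :
    PolyDecidable fun M v => M.boxes.SPrec (f M v) (g M v) :=
  (polyDecidable_prec hf hg).and (polyDecidable_prec hg hf).not

theorem polyDecidable_meets (hf : PolyComputable f) (hg : PolyComputable g) :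
    PolyDecidable fun M v => M.boxes.Meets (f M v) (g M v) :=
  (PolyDecidable.le (polyComputable_l hf) (polyComputable_r hg)).and <|
    (PolyDecidable.le (polyComputable_l hg) (polyComputable_r hf)).and <|
    (PolyDecidable.le (polyComputable_b hf) (polyComputable_t hg)).and
      (.le (polyComputable_b hg) (polyComputable_t hf))

theorem polyDecidable_conflict (hf : PolyComputable f) (hg : PolyComputable g) :
    PolyDecidable fun M v => M.boxes.Conflict (f M v) (g M v) :=
  (polyDecidable_meets hf hg).and <|
    (polyDecidable_sPrec hf hg).not.and (polyDecidable_sPrec hg hf).not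

open Classical in
theorem polyBounded_load (hA : A ≠ natStack) (hk : PolyBounded k) (hf : PolyComputable f)
    (hg : PolyComputable g) :
    PolyBounded fun M v => M.boxes.load (M.nat A) (k M v) (f M v) (g M v) :=
  .count hk (polyDecidable_covers (.natGet hA (.var _)) hf.weaken hg.weaken)

open Classical in
theorem polyBounded_colorLoad (hA : A ≠ natStack) (hC : C ≠ natStack) (hk : PolyBounded k)
    (hf : PolyComputable f) (hg : PolyComputable g) (hh : PolyComputable h) :
    PolyBounded fun M v =>
      M.boxes.colorLoad (M.nat A) (M.nat C) (k M v) (f M v) (g M v) (h M v) :=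
  .count hk <| (polyDecidable_covers (.natGet hA (.var _)) hf.weaken hg.weaken).and
    (.eq (.natGet hC (.var _)) hh.weaken)

theorem polyComputable_sum_grid {F : State → (Fin d → ℕ) → ℕ → ℕ → α}
    (hF : PolyComputable fun M (v : Fin (d + 1 + 1) → ℕ) => F M (fun i => v i.castSucc.castSucc)
      (v (Fin.last d).castSucc) (v (Fin.last (d + 1)))) :
    PolyComputable fun M v => ∑ p ∈ M.boxes.grid, F M v p.1 p.2 := by
  simp only [BoxData.grid, Finset.sum_product]
  exact .sum polyBounded_n (.sum polyBounded_n hF)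

theorem polyComputable_totalPrice (hA : A ≠ natStack) (hk : PolyBounded k) :
    PolyComputable fun M v => M.boxes.totalPrice (M.nat A) (k M v) := by
  refine polyComputable_sum_grid (F := fun M v a c => 2 ^ M.boxes.load (M.nat A) (k M v) a c) ?_
  simpa using PolyComputable.powSmul (.lit 2)
    (polyBounded_load hA hk.weaken.weaken (.var _) (.var _)) (.lit 1)

open Classical in
theorem polyComputable_price_smul (hA : A ≠ natStack) (hk : PolyBounded k)
    (hi : PolyComputable i) {x : State → (Fin d → ℕ) → α} (hx : PolyComputable x) :
    PolyComputable fun M v => M.boxes.price (M.nat A) (k M v) (i M v) • x M v := by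
  simp only [BoxData.price, Finset.sum_smul, ite_smul, zero_smul]
  exact polyComputable_sum_grid (F := fun M v a c => if M.boxes.Covers (i M v) a c then
    2 ^ M.boxes.load (M.nat A) (k M v) a c • x M v else 0) <| .ite
    (polyDecidable_covers hi.weaken.weaken (.var _) (.var _))
    (.powSmul (.lit 2) (polyBounded_load hA hk.weaken.weaken (.var _) (.var _)) hx.weaken.weaken)
    .zero

theorem polyComputable_pickRule (hA : A ≠ natStack) (hT : PolyBounded T) (hk : PolyBounded k) :
    PolyComputable fun M v => M.boxes.pickRule (T M v) (M.nat A) (k M v) := by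
  have hlimit : PolyComputable fun M v => 2 ^ T M v := by
    simpa using PolyComputable.powSmul (.lit 2) hT (.lit 1)
  exact .ite (.lt (polyComputable_totalPrice hA hk) hlimit)
    (PolyBounded.first polyBounded_n <| .all polyBounded_n <| .le
      (polyComputable_price_smul hA hk.weaken.weaken (.var _) (polyComputable_w (.var _)))
      (polyComputable_price_smul hA hk.weaken.weaken (.var _) (polyComputable_w (.var _)))).1
    polyBounded_n.1

theorem polyDecidable_remains (hA : A ≠ natStack) (hC : C ≠ natStack) (hk : PolyBounded k)
    (hf : PolyComputable f) :
    PolyDecidable fun M v => M.boxes.Remains (M.nat A) (M.nat C) (k M v) (f M v) :=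
  (PolyDecidable.lt (.natGet hA hf) polyBounded_n.1).and <|
    .all hk (.ne (.natGet hC (.var _)) hf.weaken)

open Classical in
theorem polyBounded_conflictCount (hA : A ≠ natStack) (hC : C ≠ natStack) (hL : PolyBounded L)
    (hk : PolyBounded k) (hf : PolyComputable f) :
    PolyBounded fun M v => M.boxes.conflictCount (L M v) (M.nat A) (M.nat C) (k M v) (f M v) :=
  .count hL <| (polyDecidable_remains hA hC hk.weaken (.var _)).and <|
    (PolyDecidable.ne (.var _) hf.weaken).and <|
      polyDecidable_conflict (.natGet hA (.var _)) (.natGet hA hf.weaken)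

theorem polyComputable_removeRule (hA : A ≠ natStack) (hC : C ≠ natStack) (hL : PolyBounded L)
    (hQ : PolyComputable Q) (hk : PolyBounded k) :
    PolyComputable fun M v =>
      M.boxes.removeRule (L M v) (Q M v) (M.nat A) (M.nat C) (k M v) :=
  (PolyBounded.first hL <| (polyDecidable_remains hA hC hk.weaken (.var _)).and <| .le
    (polyBounded_conflictCount hA hC hL.weaken hk.weaken (.var _)).1 hQ.weaken).1

theorem polyComputable_reverseRule (hA : A ≠ natStack) (hC : C ≠ natStack)
    (hL : PolyComputable L) (hk : PolyComputable k) :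
    PolyComputable fun M v => M.boxes.reverseRule (L M v) (M.nat A) (M.nat C) (k M v) :=
  have hpos := PolyComputable.natGet hC ((hL.sub (.lit 1)).sub hk)
  .ite (.lt hpos hL) (.natGet hA hpos) polyBounded_n.1

open Classical in
theorem polyComputable_colorCost (hA : A ≠ natStack) (hC : C ≠ natStack) (hT : PolyBounded T)
    (hQ : PolyBounded Q) (hk : PolyBounded k) (hf : PolyComputable f) :
    PolyComputable fun M v =>
      M.boxes.colorCost (T M v) (Q M v) (M.nat A) (M.nat C) (k M v) (f M v) := by
  refine polyComputable_sum_grid (F := fun M v a c => if M.boxes.Covers (M.nat A (k M v)) a c then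
    2 ^ (T M v - 1 - M.boxes.load (M.nat A) (k M v) a c) * (Q M v + 1) ^
      M.boxes.colorLoad (M.nat A) (M.nat C) (k M v) a c (f M v) else 0) (.ite
    (polyDecidable_covers (.natGet hA hk.weaken.weaken.1) (.var _) (.var _)) ?_ (.lit 0))
  simpa using PolyComputable.powSmul (.lit 2)
    ((hT.weaken.weaken.sub (.lit 1)).sub
      (polyBounded_load hA hk.weaken.weaken (.var _) (.var _)))
    (PolyComputable.powSmul (hQ.weaken.weaken.add (.lit 1))
      (polyBounded_colorLoad hA hC hk.weaken.weaken (.var _) (.var _) hf.weaken.weaken) (.lit 1))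

theorem polyComputable_colorRule (hA : A ≠ natStack) (hC : C ≠ natStack) (hT : PolyBounded T)
    (hQ : PolyBounded Q) (hk : PolyBounded k) :
    PolyComputable fun M v =>
      M.boxes.colorRule (T M v) (Q M v) (M.nat A) (M.nat C) (k M v) := by
  have hcost : PolyComputable fun M (v : Fin (d + 1) → ℕ) =>
      Q M (fun i => v i.castSucc) * M.boxes.colorCost (T M fun i => v i.castSucc)
        (Q M fun i => v i.castSucc) (M.nat A) (M.nat C) (k M fun i => v i.castSucc)
        (v (Fin.last d)) := by
    simpa using PolyComputable.powSmul hQ.weaken (.lit 1)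
      (polyComputable_colorCost hA hC hT.weaken hQ.weaken hk.weaken (.var (Fin.last d)))
  exact (PolyBounded.first ((hQ.constMul 2).add (.lit 1)) <|
    (PolyDecidable.all hk.weaken <|
      .imp (.lt (.natGet hA (.var _)) polyBounded_n.1) <|
      .imp (polyDecidable_conflict (.natGet hA (.var _)) (.natGet hA hk.weaken.weaken.1)) <|
        .ne (.natGet hC (.var _)) (.var _)).and <|
    .le hcost <| .sum ((hQ.weaken.constMul 2).add (.lit 1)) <|
      polyComputable_colorCost hA hC hT.weaken.weaken hQ.weaken.weaken hk.weaken.weaken (.var _)).1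

open Classical in
theorem polyComputable_crossings (hA : A ≠ natStack) (hC : C ≠ natStack) (hL : PolyBounded L)
    (hk : PolyComputable k) (hf : PolyComputable f) :
    PolyComputable fun M v =>
      M.boxes.crossings (L M v) (M.nat A) (M.nat C) (k M v) (f M v) :=
  have hj : PolyComputable fun M (v : Fin (d + 1) → ℕ) => M.nat A (v (Fin.last d)) :=
    .natGet hA (.var _)
  (PolyBounded.count hL <| (PolyDecidable.lt hj polyBounded_n.1).and <|
    (PolyDecidable.eq (.natGet hC (.var _)) (.natGet hC hk.weaken)).and <|
    (polyDecidable_sPrec hj (.natGet hA hk.weaken)).and <|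
    (PolyDecidable.le (polyComputable_l hj) (polyComputable_l hf.weaken)).and
      (.le (polyComputable_l hf.weaken) (polyComputable_r hj))).1

theorem polyComputable_levelRule (hA : A ≠ natStack) (hC : C ≠ natStack) (hL : PolyBounded L)
    (hk : PolyComputable k) :
    PolyComputable fun M v => M.boxes.levelRule (L M v) (M.nat A) (M.nat C) (k M v) :=
  have hbox := PolyComputable.natGet hA hk.weaken.weaken
  (PolyBounded.first hL <| .all polyBounded_n <|
    .imp (.le (polyComputable_l hbox) (polyComputable_l (.var _))) <|
    .imp (.le (polyComputable_l (.var _)) (polyComputable_r hbox)) <|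
    .le (polyComputable_crossings hA hC hL.weaken.weaken hk.weaken.weaken (.var _)) (.var _)).1

theorem polyComputable_classWeight (hA : A ≠ natStack) (hC : C ≠ natStack) (hH : H ≠ natStack)
    (hL : PolyBounded L) (hf : PolyComputable f) (hg : PolyComputable g) :
    PolyComputable fun M v =>
      M.boxes.classWeight (L M v) (M.nat A) (M.nat C) (M.nat H) (f M v) (g M v) :=
  have hj : PolyComputable fun M (v : Fin (d + 1) → ℕ) => M.nat A (v (Fin.last d)) :=
    .natGet hA (.var _)
  .sum hL <| .ite
    ((PolyDecidable.lt hj polyBounded_n.1).and <|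
      (PolyDecidable.eq (.natGet hC (.var _)) hf.weaken).and
        (.eq (.natGet hH (.var _)) hg.weaken))
    (polyComputable_w hj) .zero

theorem polyDecidable_isHeaviest (hA : A ≠ natStack) (hC : C ≠ natStack) (hH : H ≠ natStack)
    (hQ : PolyBounded Q) (hL : PolyBounded L) (hf : PolyComputable f) (hg : PolyComputable g) :
    PolyDecidable fun M v =>
      M.boxes.IsHeaviest (Q M v) (L M v) (M.nat A) (M.nat C) (M.nat H) (f M v) (g M v) :=
  .all hQ <| .all hL.weaken <| .le
    (polyComputable_classWeight hA hC hH hL.weaken.weaken (.var _) (.var _))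
    (polyComputable_classWeight hA hC hH hL.weaken.weaken hf.weaken.weaken hg.weaken.weaken)

theorem polyComputable_selectRule (hA : A ≠ natStack) (hC : C ≠ natStack) (hH : H ≠ natStack)
    (hL : PolyBounded L) (hf : PolyComputable f) (hg : PolyComputable g)
    (hk : PolyComputable k) :
    PolyComputable fun M v =>
      BoxData.selectRule (L M v) (M.nat A) (M.nat C) (M.nat H) (f M v) (g M v) (k M v) :=
  .ite (.ex hL <| (PolyDecidable.eq (.natGet hA (.var _)) hk.weaken).and <|
    (PolyDecidable.eq (.natGet hC (.var _)) hf.weaken).and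
      (.eq (.natGet hH (.var _)) hg.weaken))
    (.lit 1) (.lit 0)

end RealRAM

/-! ## The approximation guarantee -/

namespace BoxData

/-- The limit on the load of the grid points in the greedy list of `n` boxes. -/
def depthLimit (n : ℕ) : ℕ := 4 * Nat.clog 2 n

/-- The length of the lists. Each box of the greedy list raises the total price, so that the list
ends before it has `2 ^ depthLimit n` boxes. -/
def listLength (n : ℕ) : ℕ := 2 ^ depthLimit n

/-- The limit on the number of conflicts of a box with the earlier boxes of the reversed list. -/
def conflictLimit (n : ℕ) : ℕ := 8 * depthLimit n

/-- The arrays hold the results of the phases of the algorithm: the greedy list `e`, the removal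
order `ord`, the reversed list `s` with colours `col` and levels `lev`, the colour `z` and the
level `m` of a heaviest class, and the marks `out` of the boxes in this class. -/
structure IsRun (X : BoxData) (e ord s col lev : ℕ → ℕ) (z m : ℕ) (out : ℕ → ℕ) : Prop where
  isGreedy : X.IsGreedy (listLength X.n) (depthLimit X.n) e
  isReversal : X.IsReversal (listLength X.n) (conflictLimit X.n) e ord s
  col_eq : ∀ k < listLength X.n,
    col k = X.colorRule (depthLimit X.n) (conflictLimit X.n) s col k
  isLeveling : X.IsLeveling (listLength X.n) s col lev
  isHeaviest : X.IsHeaviest (2 * conflictLimit X.n + 1) (listLength X.n) s col lev z m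
  out_eq : ∀ i < listLength X.n, out i = selectRule (listLength X.n) s col lev z m i

theorem le_listLength (n : ℕ) : n ≤ listLength n :=
  (Nat.le_pow_clog one_lt_two n).trans (Nat.pow_le_pow_right two_pos (by unfold depthLimit; omega))

theorem isHeaviest_first (X : BoxData) {C L : ℕ} (hC : 0 < C) (hL : 0 < L) (s col lev : ℕ → ℕ)
    {z m : ℕ} (hz : z = first C fun y => ∃ x < L, X.IsHeaviest C L s col lev y x)
    (hm : m = first L fun x => X.IsHeaviest C L s col lev z x) :
    X.IsHeaviest C L s col lev z m := by
  obtain ⟨q, hq, hmax⟩ := Finset.exists_max_image (Finset.range C ×ˢ Finset.range L)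
    (fun q => X.classWeight L s col lev q.1 q.2) ⟨(0, 0), by simp [hC, hL]⟩
  simp only [Finset.mem_product, Finset.mem_range] at hq hmax
  have hlevel : ∃ x < L, X.IsHeaviest C L s col lev z x := by
    rw [hz]
    exact (first_spec (q := fun y => ∃ x < L, X.IsHeaviest C L s col lev y x)
      ⟨q.1, hq.1, q.2, hq.2, fun y hy x hx => hmax (y, x) ⟨hy, hx⟩⟩).2
  rw [hm]
  exact (first_spec hlevel).2

theorem Valid.sum_filter_nonneg {X : BoxData} (hX : X.Valid) {q : ℕ → Prop} [DecidablePred q] :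
    0 ≤ ∑ i ∈ Finset.range X.n with q i, X.w i :=
  Finset.sum_nonneg fun i hi => (hX.w_pos i (Finset.mem_range.1 (Finset.mem_filter.1 hi).1)).le

section Logarithms

variable {n D : ℕ}

theorem log_le_clog (n : ℕ) : Real.log n ≤ Nat.clog 2 n := by
  rcases n.eq_zero_or_pos with rfl | hn
  · simp
  calc Real.log n ≤ Real.log (2 ^ Nat.clog 2 n) :=
        Real.log_le_log (by exact_mod_cast hn) (by exact_mod_cast Nat.le_pow_clog one_lt_two n)
    _ = Nat.clog 2 n * Real.log 2 := Real.log_pow _ _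
    _ ≤ Nat.clog 2 n := mul_le_of_le_one_right (Nat.cast_nonneg _)
        (Real.log_two_lt_d9.le.trans (by norm_num))

theorem depthBound_le_pow (hn : 3 ≤ n) :
    n ^ 2 * (2 ^ depthLimit n * (2 * conflictLimit n + 1)) ≤ n ^ 15 := by
  have hclog : Nat.clog 2 n ≤ n := Nat.clog_le_of_le_pow n.lt_two_pow_self.le
  have hlength : 2 ^ depthLimit n ≤ (3 * n) ^ 4 := by
    rw [depthLimit, mul_comm, pow_mul]
    exact Nat.pow_le_pow_left ((RealRAM.two_pow_clog_le n).trans (by omega)) 4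
  have hcolors : 2 * conflictLimit n + 1 ≤ 65 * n := by unfold conflictLimit depthLimit; omega
  calc n ^ 2 * (2 ^ depthLimit n * (2 * conflictLimit n + 1))
      ≤ n ^ 2 * ((3 * n) ^ 4 * (65 * n)) := by gcongr
    _ = 5265 * n ^ 7 := by ring
    _ ≤ n ^ 8 * n ^ 7 := by gcongr; exact le_trans (by norm_num) (Nat.pow_le_pow_left hn 8)
    _ = n ^ 15 := by ring

theorem mul_log_log_le (hn : 3 ≤ n) (hD : (conflictLimit n + 1) ^ D ≤ n ^ 15) :
    D * Real.log (Real.log n) ≤ 15 * Real.log n := by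
  have hlog : 0 < Real.log n := Real.log_pos (by exact_mod_cast (by omega : 1 < n))
  have hle : Real.log n ≤ (conflictLimit n + 1 : ℕ) := (log_le_clog n).trans <| by
    exact_mod_cast (by unfold conflictLimit depthLimit; omega)
  calc D * Real.log (Real.log n) ≤ D * Real.log (conflictLimit n + 1 : ℕ) := by gcongr
    _ = Real.log ((conflictLimit n + 1) ^ D : ℕ) := by rw [Nat.cast_pow, Real.log_pow]
    _ ≤ Real.log (n ^ 15 : ℕ) :=
        Real.log_le_log (by exact_mod_cast Nat.pow_pos (Nat.succ_pos _)) (by exact_mod_cast hD)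
    _ = 15 * Real.log n := by rw [Nat.cast_pow, Real.log_pow]; norm_num

end Logarithms

namespace IsRun

variable {X : BoxData} {e ord s col lev out : ℕ → ℕ} {z m i j : ℕ} {J : Finset ℕ}

theorem isDegenerate (h : X.IsRun e ord s col lev z m out) :
    X.IsDegenerate (listLength X.n) (conflictLimit X.n) e :=
  isDegenerate_of_load_le fun _ hp => h.isGreedy.load_le le_rfl hp

theorem isColoring (h : X.IsRun e ord s col lev z m out) :
    X.IsColoring (listLength X.n) (depthLimit X.n) (conflictLimit X.n) s col where
  load_le p hp := (h.isReversal.load_eq h.isDegenerate p.1 p.2).trans_le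
    (h.isGreedy.load_le le_rfl hp)
  card_conflict_le _ hk hs := h.isReversal.card_conflict_le hk hs
  eq_rule := h.col_eq

theorem out_ne_zero_iff (h : X.IsRun e ord s col lev z m out) (hi : i < X.n) :
    out i ≠ 0 ↔ ∃ k < listLength X.n, s k = i ∧ col k = z ∧ lev k = m := by
  rw [h.out_eq i (hi.trans_le (le_listLength _)), selectRule]
  simp

theorem not_meets_of_ne {j k : ℕ} (h : X.IsRun e ord s col lev z m out) (hX : X.Valid)
    (hj : j < listLength X.n) (hk : k < listLength X.n) (hsj : s j < X.n) (hsk : s k < X.n)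
    (hc : col j = col k) (hl : lev j = lev k) (hjk : j ≠ k) : ¬ X.Meets (s j) (s k) := by
  rcases hjk.lt_or_gt with hlt | hlt
  · exact h.isLeveling.not_meets h.isColoring hX hlt hk hsj hsk hc hl
  · exact fun ⟨hx, hx', hy, hy'⟩ => h.isLeveling.not_meets h.isColoring hX hlt hj hsk hsj hc.symm
      hl.symm ⟨hx', hx, hy', hy⟩

theorem not_meets (h : X.IsRun e ord s col lev z m out) (hX : X.Valid) (hi : i < X.n)
    (hj : j < X.n) (hoi : out i ≠ 0) (hoj : out j ≠ 0) (hij : i ≠ j) : ¬ X.Meets i j := by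
  obtain ⟨u, hu, rfl, hcu, hlu⟩ := (h.out_ne_zero_iff hi).1 hoi
  obtain ⟨v, hv, rfl, hcv, hlv⟩ := (h.out_ne_zero_iff hj).1 hoj
  exact h.not_meets_of_ne hX hu hv hi hj (hcu.trans hcv.symm) (hlu.trans hlv.symm)
    fun huv => hij (congrArg s huv)

theorem sum_out (h : X.IsRun e ord s col lev z m out) (hX : X.Valid) :
    ∑ i ∈ Finset.range X.n with out i ≠ 0, X.w i =
      X.classWeight (listLength X.n) s col lev z m := by
  classical
  rw [classWeight, ← Finset.sum_filter]
  set F := {k ∈ Finset.range (listLength X.n) | s k < X.n ∧ col k = z ∧ lev k = m}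
  have hF {k} : k ∈ F ↔ k < listLength X.n ∧ s k < X.n ∧ col k = z ∧ lev k = m := by simp [F]
  have himage : ({i ∈ Finset.range X.n | out i ≠ 0} : Finset ℕ) = F.image s := by
    ext i
    rw [Finset.mem_filter, Finset.mem_range, Finset.mem_image]
    constructor
    · rintro ⟨hi, hoi⟩
      obtain ⟨k, hk, rfl, hz, hm⟩ := (h.out_ne_zero_iff hi).1 hoi
      exact ⟨k, hF.2 ⟨hk, hi, hz, hm⟩, rfl⟩
    · rintro ⟨k, hkF, rfl⟩
      obtain ⟨hk, hsk, hz, hm⟩ := hF.1 hkF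
      exact ⟨hsk, (h.out_ne_zero_iff hsk).2 ⟨k, hk, rfl, hz, hm⟩⟩
  rw [himage, Finset.sum_image]
  intro u hu v hv huv
  obtain ⟨hu, hsu, hcu, hlu⟩ := hF.1 hu
  obtain ⟨hv, hsv, hcv, hlv⟩ := hF.1 hv
  by_contra hne
  refine h.not_meets_of_ne hX hu hv hsu hsv (hcu.trans hcv.symm) (hlu.trans hlv.symm) hne ?_
  rw [← huv]
  exact ⟨hX.l_le_r _ hsu, hX.l_le_r _ hsu, hX.b_le_t _ hsu, hX.b_le_t _ hsu⟩

theorem sum_le_mul_sum_out (h : X.IsRun e ord s col lev z m out) (hX : X.Valid) (hn : 2 ≤ X.n)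
    (hJ : X.IsPacking J) :
    ∑ i ∈ J, X.w i ≤ 65 * X.colorDepth (listLength X.n) (conflictLimit X.n) s col *
      ∑ i ∈ Finset.range X.n with out i ≠ 0, X.w i := by
  set W := ∑ i ∈ Finset.range X.n with out i ≠ 0, X.w i with hW
  set D := X.colorDepth (listLength X.n) (conflictLimit X.n) s col
  set ℓ := Nat.clog 2 X.n
  have hℓ_pos : 0 < ℓ := Nat.clog_pos one_lt_two hn
  have hW_nonneg : 0 ≤ W := hX.sum_filter_nonneg
  have hcolors : 2 * conflictLimit X.n + 1 ≤ ℓ * 65 := by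
    unfold conflictLimit depthLimit; omega
  refine le_of_mul_le_mul_left ?_ (Nat.cast_pos.2 hℓ_pos : (0 : ℝ) < ℓ)
  calc ℓ * ∑ i ∈ J, X.w i
      ≤ X.listWeight e (listLength X.n) :=
        h.isGreedy.mul_sum_le_listWeight hX le_rfl (Nat.le_pow_clog one_lt_two _) hJ
    _ = X.listWeight s (listLength X.n) := (h.isReversal.listWeight_eq h.isDegenerate).symm
    _ ≤ ((2 * conflictLimit X.n + 1) * D : ℕ) * W := by
        rw [hW, h.sum_out hX]
        exact h.isLeveling.listWeight_le h.isColoring hX h.isHeaviest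
    _ ≤ ((ℓ * 65) * D : ℕ) * W := by gcongr
    _ = ℓ * (65 * D * W) := by push_cast; ring

theorem ratio_mul_sum_le (h : X.IsRun e ord s col lev z m out) (hX : X.Valid) (hn : 3 ≤ X.n)
    (hJ : X.IsPacking J) :
    1 / 975 * (Real.log (Real.log X.n) / Real.log X.n) * ∑ i ∈ J, X.w i ≤
      ∑ i ∈ Finset.range X.n with out i ≠ 0, X.w i := by
  have hsum := h.sum_le_mul_sum_out hX (by omega) hJ
  set W := ∑ i ∈ Finset.range X.n with out i ≠ 0, X.w i
  set D := X.colorDepth (listLength X.n) (conflictLimit X.n) s col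
  have hD : D * Real.log (Real.log X.n) ≤ 15 * Real.log X.n := mul_log_log_le hn <|
    (h.isColoring.pow_colorDepth_le (by omega)).trans (depthBound_le_pow hn)
  have hW_nonneg : 0 ≤ W := hX.sum_filter_nonneg
  have hlog : 1 ≤ Real.log X.n := by
    rw [Real.le_log_iff_exp_le (by positivity)]
    exact Real.exp_one_lt_three.le.trans (by exact_mod_cast hn)
  have hloglog : 0 ≤ Real.log (Real.log X.n) := Real.log_nonneg hlog
  rw [mul_div_assoc', div_mul_eq_mul_div, div_le_iff₀ (by linarith)]
  calc 1 / 975 * Real.log (Real.log X.n) * ∑ i ∈ J, X.w i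
      ≤ 1 / 975 * Real.log (Real.log X.n) * (65 * D * W) := by gcongr
    _ = 1 / 15 * (D * Real.log (Real.log X.n)) * W := by ring
    _ ≤ 1 / 15 * (15 * Real.log X.n) * W := by gcongr
    _ = W * Real.log X.n := by ring

end IsRun

end BoxData

/-! ## The program -/

namespace BoxData

variable {X : BoxData} {k : ℕ} {e e' : ℕ → ℕ}

theorem load_congr (h : ∀ j < k, e j = e' j) : X.load e k = X.load e' k := by
  funext a c
  unfold load
  congr 1
  classical
  exact Finset.filter_congr fun j hj => by rw [h j (Finset.mem_range.1 hj)]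

theorem pickRule_congr (h : ∀ j < k, e j = e' j) (T : ℕ) :
    X.pickRule T e k = X.pickRule T e' k := by
  unfold pickRule totalPrice price
  rw [load_congr h]

theorem remains_congr (h : ∀ j < k, e j = e' j) (s : ℕ → ℕ) :
    X.Remains s e k = X.Remains s e' k :=
  funext fun u => propext <| and_congr_right' <| forall₂_congr fun j hj => by rw [h j hj]

theorem removeRule_congr (h : ∀ j < k, e j = e' j) (L Q : ℕ) (s : ℕ → ℕ) :
    X.removeRule L Q s e k = X.removeRule L Q s e' k := by
  unfold removeRule conflictCount
  rw [remains_congr h]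

theorem colorLoad_congr (h : ∀ j < k, e j = e' j) (s : ℕ → ℕ) :
    X.colorLoad s e k = X.colorLoad s e' k := by
  funext a c z
  unfold colorLoad
  congr 1
  classical
  exact Finset.filter_congr fun j hj => by rw [h j (Finset.mem_range.1 hj)]

theorem colorRule_congr (h : ∀ j < k, e j = e' j) (T Q : ℕ) (s : ℕ → ℕ) :
    X.colorRule T Q s e k = X.colorRule T Q s e' k := by
  have hproper : ∀ z, (∀ j < k, s j < X.n → X.Conflict (s j) (s k) → e j ≠ z) ↔
      ∀ j < k, s j < X.n → X.Conflict (s j) (s k) → e' j ≠ z := fun z =>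
    forall₂_congr fun j hj => by rw [h j hj]
  simp only [colorRule, colorCost, colorLoad_congr h, hproper]

end BoxData

namespace RealRAM

open BoxData

/-- The array that receives the greedy list. -/
abbrev pickArray : ℕ := 3

/-- The array that receives the removal order. -/
abbrev removalArray : ℕ := 4

/-- The array that receives the reversed list. -/
abbrev sequenceArray : ℕ := 5

/-- The array that receives the colours of the reversed list. -/
abbrev colorArray : ℕ := 6

/-- The array that receives the levels of the reversed list. -/
abbrev levelArray : ℕ := 7

/-- The array that receives the colour of a heaviest class, in every cell. -/
abbrev bestColorArray : ℕ := 8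

/-- The array that receives the level of a heaviest class, in every cell. -/
abbrev bestLevelArray : ℕ := 9

/-- The stages of the algorithm. The last one fills the array `1` from which the output is read. -/
noncomputable def stages : List Stage :=
  [⟨pickArray, [0], fun M =>
      M.boxes.pickRule (depthLimit M.size) (M.nat pickArray)⟩,
   ⟨removalArray, [0, pickArray], fun M =>
      M.boxes.removeRule (listLength M.size) (conflictLimit M.size) (M.nat pickArray)
        (M.nat removalArray)⟩,
   ⟨sequenceArray, [0, pickArray, removalArray], fun M =>
      M.boxes.reverseRule (listLength M.size) (M.nat pickArray) (M.nat removalArray)⟩,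
   ⟨colorArray, [0, sequenceArray], fun M =>
      M.boxes.colorRule (depthLimit M.size) (conflictLimit M.size) (M.nat sequenceArray)
        (M.nat colorArray)⟩,
   ⟨levelArray, [0, sequenceArray, colorArray], fun M =>
      M.boxes.levelRule (listLength M.size) (M.nat sequenceArray) (M.nat colorArray)⟩,
   ⟨bestColorArray, [0, sequenceArray, colorArray, levelArray], fun M _ =>
      first (2 * conflictLimit M.size + 1) fun z => ∃ m < listLength M.size,
        M.boxes.IsHeaviest (2 * conflictLimit M.size + 1) (listLength M.size)
          (M.nat sequenceArray) (M.nat colorArray) (M.nat levelArray) z m⟩,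
   ⟨bestLevelArray, [0, sequenceArray, colorArray, levelArray, bestColorArray], fun M _ =>
      first (listLength M.size) fun m =>
        M.boxes.IsHeaviest (2 * conflictLimit M.size + 1) (listLength M.size)
          (M.nat sequenceArray) (M.nat colorArray) (M.nat levelArray) (M.nat bestColorArray 0) m⟩,
   ⟨1, [0, sequenceArray, colorArray, levelArray, bestColorArray, bestLevelArray], fun M =>
      selectRule (listLength M.size) (M.nat sequenceArray) (M.nat colorArray) (M.nat levelArray)
        (M.nat bestColorArray 0) (M.nat bestLevelArray 0)⟩]

theorem polyBounded_depthLimit {d : ℕ} : PolyBounded (d := d) fun M _ => depthLimit M.size :=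
  PolyBounded.clog_size.constMul 4

theorem polyBounded_conflictLimit {d : ℕ} :
    PolyBounded (d := d) fun M _ => conflictLimit M.size :=
  polyBounded_depthLimit.constMul 8

theorem polyBounded_listLength {d : ℕ} : PolyBounded (d := d) fun M _ => listLength M.size :=
  PolyBounded.two_pow_clog_size 4

theorem performs_stages : Performs (Stage.run listLength stages) := by
  have hcolors {d : ℕ} : PolyBounded (d := d) fun M _ => 2 * conflictLimit M.size + 1 :=
    (polyBounded_conflictLimit.constMul 2).add (.lit 1)
  have hcell {d a : ℕ} (ha : a ≠ natStack) : PolyComputable (d := d) fun M _ => M.nat a 0 :=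
    .natGet ha (.lit 0)
  apply Stage.performs_run
  simp only [stages, List.forall_mem_cons, List.not_mem_nil, false_imp_iff, implies_true, and_true]
  refine ⟨?_, ?_, ?_, ?_, ?_, ?_, ?_, ?_⟩ <;>
    refine performs_fill polyBounded_listLength (by decide) (by decide) ?_
  · exact polyComputable_pickRule (by decide) polyBounded_depthLimit (.var 0)
  · exact polyComputable_removeRule (by decide) (by decide) polyBounded_listLength
      polyBounded_conflictLimit.1 (.var 0)
  · exact polyComputable_reverseRule (by decide) (by decide) polyBounded_listLength.1 (.var 0)
  · exact polyComputable_colorRule (by decide) (by decide) polyBounded_depthLimit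
      polyBounded_conflictLimit (.var 0)
  · exact polyComputable_levelRule (by decide) (by decide) polyBounded_listLength (.var 0)
  · exact (PolyBounded.first hcolors <| .ex polyBounded_listLength <|
      polyDecidable_isHeaviest (by decide) (by decide) (by decide) hcolors polyBounded_listLength
        (.var _) (.var _)).1
  · exact (PolyBounded.first polyBounded_listLength <|
      polyDecidable_isHeaviest (by decide) (by decide) (by decide) hcolors polyBounded_listLength
        (hcell (by decide)) (.var _)).1
  · exact polyComputable_selectRule (by decide) (by decide) (by decide) polyBounded_listLength
      (hcell (by decide)) (hcell (by decide)) (.var 0)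

theorem State.boxes_congr {M N : State} (h : M.real = N.real) (h' : M.nat 0 = N.nat 0) :
    M.boxes = N.boxes := by
  rw [State.boxes, State.boxes, h, h']

theorem State.size_congr {M N : State} (h : M.nat 0 = N.nat 0) : M.size = N.size := congrFun h 0

theorem local_stages : ∀ σ ∈ stages, σ.Local := by
  simp only [stages, List.forall_mem_cons, List.not_mem_nil, false_imp_iff, implies_true, and_true]
  refine ⟨?_, ?_, ?_, ?_, ?_, ?_, ?_, ?_⟩ <;> intro M N k hreal hread hprev <;>
    simp only [List.forall_mem_cons, List.not_mem_nil, false_imp_iff, implies_true, and_true]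
      at hread hprev ⊢
  · rw [State.size_congr hread, State.boxes_congr hreal hread, pickRule_congr hprev]
  · obtain ⟨h₀, hpick⟩ := hread
    rw [State.size_congr h₀, State.boxes_congr hreal h₀, hpick, removeRule_congr hprev]
  · obtain ⟨h₀, hpick, hremoval⟩ := hread
    rw [State.size_congr h₀, State.boxes_congr hreal h₀, hpick, hremoval]
  · obtain ⟨h₀, hseq⟩ := hread
    rw [State.size_congr h₀, State.boxes_congr hreal h₀, hseq, colorRule_congr hprev]
  · obtain ⟨h₀, hseq, hcolor⟩ := hread
    rw [State.size_congr h₀, State.boxes_congr hreal h₀, hseq, hcolor]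
  · obtain ⟨h₀, hseq, hcolor, hlevel⟩ := hread
    rw [State.size_congr h₀, State.boxes_congr hreal h₀, hseq, hcolor, hlevel]
  · obtain ⟨h₀, hseq, hcolor, hlevel, hz⟩ := hread
    rw [State.size_congr h₀, State.boxes_congr hreal h₀, hseq, hcolor, hlevel, hz]
  · obtain ⟨h₀, hseq, hcolor, hlevel, hz, hm⟩ := hread
    rw [State.size_congr h₀, hseq, hcolor, hlevel, hz, hm]

theorem solved_stages (M : State) :
    ∀ σ ∈ stages, σ.Solved listLength (Stage.run listLength stages M) :=
  Stage.solved_run local_stages (by simp [stages]) (by simp [stages]) (by simp [stages]) M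

theorem isRun_of_solved {M : State} (h : ∀ σ ∈ stages, σ.Solved listLength M) :
    M.boxes.IsRun (M.nat pickArray) (M.nat removalArray) (M.nat sequenceArray) (M.nat colorArray)
      (M.nat levelArray) (M.nat bestColorArray 0) (M.nat bestLevelArray 0) (M.nat 1) := by
  simp only [stages, List.forall_mem_cons, List.not_mem_nil, false_imp_iff, implies_true,
    and_true, Stage.Solved] at h
  obtain ⟨hpick, hremoval, hseq, hcolor, hlevel, hz, hm, hout⟩ := h
  have hL : 0 < listLength M.size := Nat.two_pow_pos _
  exact ⟨hpick, ⟨hremoval, hseq⟩, hcolor, hlevel,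
    isHeaviest_first _ (Nat.succ_pos _) hL _ _ _ (hz 0 hL) (hm 0 hL), hout⟩

end RealRAM

/-! ## Input and output -/

namespace RealRAM

variable {n : ℕ} {B : Fin n → WeightedBox}

theorem boxes_input (B : Fin n → WeightedBox) (i : Fin n) :
    (input B).boxes.l i = (B i).left ∧ (input B).boxes.r i = (B i).right ∧
      (input B).boxes.b i = (B i).bottom ∧ (input B).boxes.t i = (B i).top ∧
      (input B).boxes.w i = (B i).weight := by
  simp [State.boxes, input]

theorem valid_input (B : Fin n → WeightedBox) : (input B).boxes.Valid where
  l_le_r i hi := by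
    obtain ⟨hl, hr, -⟩ := boxes_input B ⟨i, hi⟩
    exact (hl.trans_le (B _).left_le_right).trans_eq hr.symm
  b_le_t i hi := by
    obtain ⟨-, -, hb, ht, -⟩ := boxes_input B ⟨i, hi⟩
    exact (hb.trans_le (B _).bottom_le_top).trans_eq ht.symm
  w_pos i hi := (B ⟨i, hi⟩).weight_pos.trans_eq (boxes_input B ⟨i, hi⟩).2.2.2.2.symm

theorem meets_input {i j : Fin n} (h : ((B i).region ∩ (B j).region).Nonempty) :
    (input B).boxes.Meets i j := by
  obtain ⟨p, ⟨⟨hil, hir⟩, hib, hit⟩, ⟨hjl, hjr⟩, hjb, hjt⟩ := h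
  simp only [BoxData.Meets, boxes_input]
  exact ⟨hil.trans hjr, hjl.trans hir, hib.trans hjt, hjb.trans hit⟩

theorem mem_region_of_covers {i : Fin n} {a c : ℕ} (h : (input B).boxes.Covers i a c) :
    ((input B).boxes.l a, (input B).boxes.b c) ∈ (B i).region := by
  simp only [BoxData.Covers, boxes_input] at h
  exact ⟨⟨h.2.1, h.2.2.1⟩, h.2.2.2⟩

theorem isPacking_input {J : Finset (Fin n)} (hJ : WeightedBox.IsIndependent B J) :
    (input B).boxes.IsPacking (J.map Fin.valEmbedding) where
  lt_n i hi := by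
    obtain ⟨i, -, rfl⟩ := Finset.mem_map.1 hi
    exact i.isLt
  disjoint i hi j hj hij a c hcov hcov' := by
    obtain ⟨i, hiJ, rfl⟩ := Finset.mem_map.1 hi
    obtain ⟨j, hjJ, rfl⟩ := Finset.mem_map.1 hj
    exact Set.eq_empty_iff_forall_notMem.1 (hJ i hiJ j hjJ (ne_of_apply_ne _ hij)) _
      ⟨mem_region_of_covers hcov, mem_region_of_covers hcov'⟩

theorem sum_w_input (B : Fin n → WeightedBox) (J : Finset (Fin n)) :
    ∑ i ∈ J.map Fin.valEmbedding, (input B).boxes.w i = WeightedBox.totalWeight B J := by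
  rw [Finset.sum_map]
  exact Finset.sum_congr rfl fun i _ => (boxes_input B i).2.2.2.2

theorem map_output (n : ℕ) (s : State) :
    (output n s).map Fin.valEmbedding = {i ∈ Finset.range n | s.nat 1 i ≠ 0} := by
  ext i
  simp only [output, Finset.mem_map, Finset.mem_filter, Finset.mem_univ, true_and,
    Finset.mem_range, Fin.valEmbedding_apply]
  exact ⟨fun ⟨j, hj, hji⟩ => hji ▸ ⟨j.isLt, hj⟩, fun ⟨hi, hne⟩ => ⟨⟨i, hi⟩, hne, rfl⟩⟩

section

variable {e ord seq col lev : ℕ → ℕ} {z m : ℕ} {s : State}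

theorem isIndependent_output (h : (input B).boxes.IsRun e ord seq col lev z m (s.nat 1)) :
    WeightedBox.IsIndependent B (output n s) := by
  intro i hi j hj hij
  by_contra hne
  exact h.not_meets (valid_input B) i.isLt j.isLt (Finset.mem_filter.1 hi).2
    (Finset.mem_filter.1 hj).2 (Fin.val_ne_of_ne hij)
    (meets_input (Set.nonempty_iff_ne_empty.2 hne))

theorem ratio_mul_opt_le (h : (input B).boxes.IsRun e ord seq col lev z m (s.nat 1))
    (hn : 3 ≤ n) :
    1 / 975 * (Real.log (Real.log n) / Real.log n) * WeightedBox.opt B ≤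
      WeightedBox.totalWeight B (output n s) := by
  obtain ⟨⟨J, hJ, hopt⟩, -⟩ := WeightedBox.isGreatest_opt B
  rw [← hopt, ← sum_w_input, ← sum_w_input, map_output]
  exact h.ratio_mul_sum_le (valid_input B) hn (isPacking_input hJ)

end

theorem exists_program_isRun : ∃ (P : Program) (p : Polynomial ℕ),
    ∀ (n : ℕ) (B : Fin n → WeightedBox), ∃ t s, Exec P (input B) t s ∧ t ≤ p.eval n ∧
      ∃ e ord seq col lev z m, (input B).boxes.IsRun e ord seq col lev z m (s.nat 1) := by
  obtain ⟨P, p, hP⟩ := performs_stages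
  refine ⟨P, p, fun n B => ?_⟩
  obtain ⟨t, s, hexec, ht, hfinal, -⟩ := hP (input B)
  rw [State.clean_input] at hfinal
  have hrun := isRun_of_solved (solved_stages (input B))
  rw [State.boxes_congr (Stage.run_real _ _) (Stage.run_nat (by simp [stages]) _),
    ← hfinal] at hrun
  have houtput : s.clean.nat 1 = s.nat 1 := funext (s.clean_nat (by decide))
  rw [houtput] at hrun
  exact ⟨t, s, hexec, ht, _, _, _, _, _, _, _, hrun⟩

end RealRAM

theorem mainTheorem7 :
    ∃ (P : RealRAM.Program) (p : Polynomial ℕ) (c : ℝ), 0 < c ∧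
      ∀ (n : ℕ) (B : Fin n → WeightedBox),
        ∃ (t : ℕ) (s : RealRAM.State),
          RealRAM.Exec P (RealRAM.input B) t s ∧
          t ≤ p.eval n ∧
          WeightedBox.IsIndependent B (RealRAM.output n s) ∧
          (3 ≤ n →
            c * (Real.log (Real.log n) / Real.log n) * WeightedBox.opt B ≤
              WeightedBox.totalWeight B (RealRAM.output n s)) := by
  obtain ⟨P, p, hP⟩ := RealRAM.exists_program_isRun
  refine ⟨P, p, 1 / 975, by norm_num, fun n B => ?_⟩
  obtain ⟨t, s, hexec, ht, _, _, _, _, _, _, _, hrun⟩ := hP n B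
  exact ⟨t, s, hexec, ht, RealRAM.isIndependent_output hrun,
    fun hn => RealRAM.ratio_mul_opt_le hrun hn⟩
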